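/- **Setting.** Let $\mathcal A$ be a set of $m\ge 1$ agents, $\mathcal I$ a set of $m$ incentives, and $\mathcal P=\mathcal A\times\mathcal I$ the set of edges, partitioned into classes $\xi$ with capacities $b_\xi\in\mathbb N$. A set $M\subseteq\mathcal P$ is *feasible* if every agent and every incentive lies in at most one edge of $M$ and $|M\cap\xi|\le b_\xi$ for every class $\xi$. Agent $a$ has a finite type space $\Theta_a$. Every edge $(a,i)$ has an irreducible and aperiodic transition matrix $P_{a,i}$ on $\Theta_a$, with stationary distribution $\pi_{a,i}$, and for every $\theta\in\Theta_a$ a reward distribution $\mathcal T_r(a,i,\theta)$ on $[0,1]$ with mean $\bar r_{a,i}(\theta)$. Put $\mu_{a,i}=\sum_\theta \pi_{a,i}(\theta)\bar r_{a,i}(\theta)$. The *greedy algorithm* with weights $w$ starts with $G=\emptyset$, $E'=\mathcal P$ and, while $E'\neq\emptyset$, takes an edge $(a,i)\in E'$ of maximal weight (ties broken arbitrarily); if $G$ contains fewer than $b_\xi$ edges of the class $\xi$ of $(a,i)$, it adds $(a,i)$ to $G$ and removes from $E'$ all edges containing $a$ or $i$, otherwise it removes $(a,i)$ from $E'$. Let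 $G^*$ be its output for the weights $\mu$; assume that every agent $a$ is matched in $G^*$, to $i^*(a)$ say. Write $G^*=\{g_1^*,\dots,g_m^*\}$ with $\mu_{g^*_1}\ge\dots\ge\mu_{g^*_m}$, let $H_j$ be the set of edges whose addition to $\{g_1^*,\dots,g_j^*\}$ violates feasibility, and let $L_1^*=H_1$, $L^*_j=H_j\setminus H_{j-1}$ for $j\ge2$. Let $\mathcal S=\{(a,i):\mu_{a,i}<\mu_{a,i^*(a)}\}$ be the set of sub-optimal edges, and define the gaps $$\Delta_{a,i}=\begin{cases}\mu_{a,i^*(a)}-\mu_{a,i},&(a,i)\in\mathcal S,\\ \mu_{g^*_{j-1}}-\mu_{g_j^*},&(a,i)=g_j^*,\ j\ge2,\\ \mu_{g^*_j}-\mu_{a,i},&(a,i)\in L_j^*\setminus(G^*\cup\mathcal S).\end{cases}$$ Assume $\Delta_{a,i}\ne0$ for all $(a,i)\in\mathcal P\setminus\{g_1^*\}$. **Process.** Let $\tau_0,\zeta\ge1$ be integers. Epoch $k=1,2,\dots$ consists of $\tau_k=\tau_0+\zeta k$ iterations, during which one matching $\alpha(k)$, chosen at the beginning of the epoch on the basis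 of the past, is played. In every iteration, for each $(a,i)\in\alpha(k)$ with agent $a$ in state $\theta$, a reward is drawn from $\mathcal T_r(a,i,\theta)$ and the state of $a$ moves according to $P_{a,i}(\theta,\cdot)$; given the past, all these draws are independent. The observed reward of $(a,i)\in\alpha(k)$ in epoch $k$ is the average of its rewards over the $\tau_k$ iterations. Let $T_{a,i}(n)$ be the number of epochs $k\le n$ with $(a,i)\in\alpha(k)$. **Constants.** Call $C>0$ a *mixing constant* of the edge $(a,i)$ if, from every initial state and for every $\tau\ge1$, the expected average reward over $\tau$ iterations of the edge differs from $\mu_{a,i}$ by at most $C/(2\tau)$. Given mixing constants $C_{a,i}$, put $\rho_{a,i}=\big(\tfrac{\zeta}{\zeta+\tau_0}+1\big)\tfrac{C_{a,i}}{2\sqrt\zeta}$. **Algorithm (MG-EUCB).** In some number $p$ of initial epochs it plays feasible matchings that contain every edge exactly once. In every later epoch $t$ it plays an output of the greedy algorithm for the weights $\bar R_{a,i}+c^{k}_{a,i}(t)$, where $k=T_{a,i}(t-1)$, $\bar R_{a,i}$ is the average of the $k$ epoch rewards of $(a,i)$ observed so far, and $$c^k_{a,i}(t)=\frac{C_{a,i}}{2k}\Big(\frac1{\zeta+\tau_0}+\frac1\zeta\log\big(1+\tfrac{k\zeta}{\tau_0}\big)\Big)+\sqrt{\tfrac6k\log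 t+\tfrac4k\log m}.$$ **Theorem.** Every edge has a mixing constant. For every choice of mixing constants $C_{a,i}$, if $\alpha$ is MG-EUCB, then for every $(a,i)\in\mathcal S$ and every $n\ge1$, $$\mathbb E[T_{a,i}(n)]\le\frac{4m^2}{\Delta_{a^*,i^*}^2}\Big(\frac{\rho_{a^*,i^*}}{\sqrt{\tau_0}}+\sqrt{6\log n+4\log m}\Big)^2+2(1+\log n),$$ where $(a^*,i^*)$ is any edge maximizing $\Big\lceil\frac4{\Delta_{a_1,i_1}^2}\big(\frac{\rho_{a_1,i_1}}{\sqrt{\tau_0}}+\sqrt{6\log n+4\log m}\big)^2\Big\rceil$ over $(a_1,i_1)\in\mathcal P\setminus\{g_1^*\}$. In particular, for a fixed instance, $\mathbb E[T_{a,i}(n)]=O(\log n)$ as $n\to\infty$ for every $(a,i)\in\mathcal S$. -/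

import Mathlib

open MeasureTheory ProbabilityTheory Filter Finset Asymptotics

noncomputable section

namespace MGEUCB

/-! ### Finite Markov chains -/

/-- The period of every state is one: the only common divisor of the possible return times
to `s` is `1`. -/
def IsAperiodic {S : Type*} [Fintype S] [DecidableEq S] (P : Matrix S S ℝ) : Prop :=
  ∀ s : S, ∀ d : ℕ, (∀ t : ℕ, 1 ≤ t → 0 < (P ^ t) s s → d ∣ t) → d = 1

/-- `π` is a stationary probability distribution of the transition matrix `P`. -/
def IsStationaryDist {S : Type*} [Fintype S] (P : Matrix S S ℝ) (π : S → ℝ) : Prop :=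
  π ∈ stdSimplex ℝ S ∧ Matrix.vecMul π P = π

/-- `C` bounds, up to the factor `1 / (2 τ)`, the distance between the stationary reward `μ` and the
expected time-averaged reward over `τ` iterations of the chain, from whatever state it is started;
`f s` is the mean reward in state `s`. -/
def IsMixingConstant {S : Type*} [Fintype S] [DecidableEq S]
    (P : Matrix S S ℝ) (f : S → ℝ) (μ C : ℝ) : Prop :=
  0 < C ∧ ∀ τ : ℕ, 1 ≤ τ → ∀ s : S,
    |μ - (1 / (τ : ℝ)) * ∑ t ∈ Finset.range τ, ∑ s' : S, (P ^ t) s s' * f s'| ≤ C / (2 * (τ : ℝ))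

/-! ### Capacitated matchings and the greedy algorithm -/

section Matching

variable {A I κ : Type*} [DecidableEq A] [DecidableEq I] [DecidableEq κ]

/-- Feasible solutions of the capacitated matching problem: every agent and every incentive is in at
most one edge, and every class `c` contributes at most `cap c` edges. -/
def Feasible (cls : A × I → κ) (cap : κ → ℕ) (M : Finset (A × I)) : Prop :=
  (∀ e ∈ M, ∀ e' ∈ M, e.1 = e'.1 → e = e') ∧
  (∀ e ∈ M, ∀ e' ∈ M, e.2 = e'.2 → e = e') ∧
  ∀ c : κ, (M.filter (fun e => cls e = c)).card ≤ cap c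

/-- One pass through the loop of the greedy algorithm with weights `w`. A state `(G, E)` consists of
the edges selected so far and of the edges still available. Ties may be broken arbitrarily. -/
inductive GreedyStep (cls : A × I → κ) (cap : κ → ℕ) (w : A × I → ℝ) :
    Finset (A × I) × Finset (A × I) → Finset (A × I) × Finset (A × I) → Prop
  | accept (G E : Finset (A × I)) (e : A × I) (he : e ∈ E) (hmax : ∀ e' ∈ E, w e' ≤ w e)
      (hcap : (G.filter (fun e' => cls e' = cls e)).card < cap (cls e)) :
      GreedyStep cls cap w (G, E) (insert e G, E.filter (fun e' => e'.1 ≠ e.1 ∧ e'.2 ≠ e.2))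
  | reject (G E : Finset (A × I)) (e : A × I) (he : e ∈ E) (hmax : ∀ e' ∈ E, w e' ≤ w e)
      (hcap : ¬ (G.filter (fun e' => cls e' = cls e)).card < cap (cls e)) :
      GreedyStep cls cap w (G, E) (G, E.erase e)

/-- `G` can be returned by the greedy algorithm on the weights `w` (for some way of breaking
ties). -/
def IsGreedyOutput [Fintype A] [Fintype I] (cls : A × I → κ) (cap : κ → ℕ) (w : A × I → ℝ)
    (G : Finset (A × I)) : Prop :=
  Relation.ReflTransGen (GreedyStep cls cap w) (∅, Finset.univ) (G, ∅)

/-! ### The benchmark matching and the reward gaps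

The benchmark matching consists of the edges `(a, iStar a)`; the bijection `σ` lists the agents, so
that `(σ 0, iStar (σ 0)), (σ 1, iStar (σ 1)), …` are its edges in order of decreasing weight. -/

/-- The `j`-th edge of the benchmark matching (counted from `0`). -/
def greedyEdge {m : ℕ} (iStar : A → I) (σ : Fin m ≃ A) (j : Fin m) : A × I := (σ j, iStar (σ j))

/-- The matching `{(a, iStar a) | a}` is a greedy matching for the weights `μ`, and `σ` lists its
edges in order of decreasing weight. -/
structure IsGreedyBenchmark [Fintype A] [Fintype I] {m : ℕ} (cls : A × I → κ) (cap : κ → ℕ)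
    (μ : A × I → ℝ) (iStar : A → I) (σ : Fin m ≃ A) : Prop where
  greedy : IsGreedyOutput cls cap μ (Finset.univ.image fun a => (a, iStar a))
  sorted : Antitone fun j : Fin m => μ (greedyEdge iStar σ j)

/-- The infeasibility set `H j`: the edges whose addition to the `j` heaviest edges of the benchmark
matching (those with index `≤ j`, counted from `0`) violates feasibility. -/
def infeasibleSet {m : ℕ} (cls : A × I → κ) (cap : κ → ℕ) (iStar : A → I) (σ : Fin m ≃ A)
    (j : Fin m) : Set (A × I) :=
  {e | ¬ Feasible cls cap (insert e ((Finset.univ.filter fun l : Fin m => l ≤ j).image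
    (greedyEdge iStar σ)))}

/-- The marginal infeasibility set `L j = H j \ H (j - 1)`, and `L j = H j` for the first `j`. -/
def marginalSet {m : ℕ} (cls : A × I → κ) (cap : κ → ℕ) (iStar : A → I) (σ : Fin m ≃ A)
    (j : Fin m) : Set (A × I) :=
  {e | e ∈ infeasibleSet cls cap iStar σ j ∧
    ∀ l : Fin m, (l : ℕ) + 1 = (j : ℕ) → e ∉ infeasibleSet cls cap iStar σ l}

/-- The sub-optimal edges: those that are worth strictly less than the edge which the benchmark
matching gives to the same agent. -/
def subOptimal (μ : A × I → ℝ) (iStar : A → I) : Set (A × I) :=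
  {e | μ e < μ (e.1, iStar e.1)}

open Classical in
/-- The reward gap of an edge. It is meaningful for all edges but the heaviest one of the
benchmark matching. -/
def gap {m : ℕ} (cls : A × I → κ) (cap : κ → ℕ) (μ : A × I → ℝ) (iStar : A → I) (σ : Fin m ≃ A)
    (e : A × I) : ℝ :=
  if e ∈ subOptimal μ iStar then μ (e.1, iStar e.1) - μ e
  else if h : ∃ j l : Fin m, greedyEdge iStar σ j = e ∧ (l : ℕ) + 1 = (j : ℕ) then
    μ (greedyEdge iStar σ h.choose_spec.choose) - μ e
  else if h : ∃ j : Fin m, e ∈ marginalSet cls cap iStar σ j then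
    μ (greedyEdge iStar σ h.choose) - μ e
  else 0

end Matching

/-! ### The model -/

/-- The data of the problem: agents `A`, incentives `I`, finite type spaces `Θ a`; for every edge an
irreducible aperiodic transition matrix and, for every type, a reward distribution on `[0, 1]`; a
partition of the edges into classes, with capacities. -/
structure Model (A I κ : Type*) (Θ : A → Type*) [∀ a, Fintype (Θ a)]
    [∀ a, DecidableEq (Θ a)] where
  /-- The transition matrix of agent `e.1` when it is matched to incentive `e.2`. -/
  P : (e : A × I) → Matrix (Θ e.1) (Θ e.1) ℝ
  stochastic : ∀ e, P e ∈ Matrix.rowStochastic ℝ (Θ e.1)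
  irreducible : ∀ e, (P e).IsIrreducible
  aperiodic : ∀ e, IsAperiodic (P e)
  /-- The distribution of the reward of an edge, given the type of the agent. -/
  rewardLaw : (e : A × I) → Θ e.1 → Measure ℝ
  rewardLaw_prob : ∀ e s, IsProbabilityMeasure (rewardLaw e s)
  rewardLaw_support : ∀ e s, rewardLaw e s (Set.Icc 0 1)ᶜ = 0
  /-- The class of an edge. -/
  cls : A × I → κ
  /-- The capacity of a class. -/
  cap : κ → ℕ

section Dynamics

variable {A I κ : Type*} {Θ : A → Type*} [∀ a, Fintype (Θ a)] [∀ a, DecidableEq (Θ a)]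

/-- The mean reward of an edge, given the type of the agent. -/
def Model.meanReward (X : Model A I κ Θ) (e : A × I) (s : Θ e.1) : ℝ :=
  ∫ x, x ∂(X.rewardLaw e s)

/-- The expected reward of an edge under the distribution `π e` on types. -/
def Model.stationaryReward (X : Model A I κ Θ) (π : (e : A × I) → Θ e.1 → ℝ) (e : A × I) : ℝ :=
  ∑ s, π e s * X.meanReward e s

/-! ### Epoch mixing policies

Epochs are numbered from `1`, iterations from `0`. -/

/-- The length of epoch `k`. -/
def epochLength (τ₀ ζ k : ℕ) : ℕ := τ₀ + ζ * k

/-- The number of iterations before epoch `k`, which is also the first iteration of that epoch. -/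
def epochStart (τ₀ ζ k : ℕ) : ℕ := ∑ j ∈ Finset.Ico 1 k, epochLength τ₀ ζ j

variable {Ω : Type*}

/-- The dynamics of the types and the rewards under a policy. In epoch `k` the matching `α k` is
played; `θ t` are the types at the beginning of iteration `t`, and `r t a` is the reward collected in
iteration `t` by agent `a` (if it is matched). The matching of an epoch is fixed
at the beginning of the epoch, on the basis of the past. Given the past up to the beginning
of iteration `t`, the rewards and the new types of the matched agents are independent, with the
reward distributions and the transition probabilities of the edges that are played. -/
structure IsEpochProcess {mΩ : MeasurableSpace Ω} (X : Model A I κ Θ) (τ₀ ζ : ℕ) (Pr : Measure Ω)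
    (ℱ : Filtration ℕ mΩ) (θ : ℕ → Ω → (a : A) → Θ a) (r : ℕ → Ω → A → ℝ)
    (α : ℕ → Ω → Finset (A × I)) : Prop where
  types_adapted : ∀ t a s, MeasurableSet[ℱ t] {ω | θ t ω a = s}
  rewards_adapted : ∀ t a, Measurable[ℱ (t + 1)] fun ω => r t ω a
  policy_adapted : ∀ k, 1 ≤ k → ∀ M, MeasurableSet[ℱ (epochStart τ₀ ζ k)] {ω | α k ω = M}
  transition : ∀ k, 1 ≤ k → ∀ t, epochStart τ₀ ζ k ≤ t → t < epochStart τ₀ ζ (k + 1) →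
    ∀ B : A → Set ℝ, (∀ a, MeasurableSet (B a)) → ∀ D : (a : A) → Finset (Θ a),
      Pr[Set.indicator {ω | ∀ e ∈ α k ω, r t ω e.1 ∈ B e.1 ∧ θ (t + 1) ω e.1 ∈ D e.1}
          (fun _ => (1 : ℝ)) | ℱ t]
        =ᵐ[Pr] fun ω => ∏ e ∈ α k ω,
          (X.rewardLaw e (θ t ω e.1)).real (B e.1) * ∑ s' ∈ D e.1, X.P e (θ t ω e.1) s'

/-- The time-averaged reward of agent `a` in epoch `k`. -/
def epochReward (τ₀ ζ : ℕ) (r : ℕ → Ω → A → ℝ) (k : ℕ) (a : A) (ω : Ω) : ℝ :=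
  (1 / (epochLength τ₀ ζ k : ℝ)) *
    ∑ t ∈ Finset.Ico (epochStart τ₀ ζ k) (epochStart τ₀ ζ (k + 1)), r t ω a

variable [DecidableEq A] [DecidableEq I]

/-- `T e n`: the number of the epochs `1, …, n` in which the edge `e` is selected. -/
def pullCount (α : ℕ → Ω → Finset (A × I)) (e : A × I) (n : ℕ) (ω : Ω) : ℕ :=
  ((Finset.Icc 1 n).filter fun k => e ∈ α k ω).card

/-- The average, over the epochs `1, …, n` in which `e` is selected, of the rewards of `e`. -/
def empiricalMean (τ₀ ζ : ℕ) (r : ℕ → Ω → A → ℝ) (α : ℕ → Ω → Finset (A × I)) (e : A × I)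
    (n : ℕ) (ω : Ω) : ℝ :=
  (∑ k ∈ (Finset.Icc 1 n).filter (fun k => e ∈ α k ω), epochReward τ₀ ζ r k e.1 ω) /
    (pullCount α e n ω : ℝ)

/-! ### The MG-EUCB algorithm -/

/-- The part of the confidence window which accounts for the mixing of the Markov chain. -/
def mixingError (τ₀ ζ : ℕ) (C : ℝ) (k : ℕ) : ℝ :=
  C / 2 * (1 / ((ζ : ℝ) + τ₀) + 1 / (ζ : ℝ) * Real.log (1 + (k : ℝ) * ζ / τ₀))

/-- The confidence window in epoch `t` of an edge that has been selected `k` times before. -/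
def confidence (τ₀ ζ m : ℕ) (C : ℝ) (k t : ℕ) : ℝ :=
  mixingError τ₀ ζ C k / k +
    Real.sqrt (6 / (k : ℝ) * Real.log t + 4 / (k : ℝ) * Real.log m)

/-- The weight of the edge `e` in epoch `n + 1`: empirical mean plus confidence window. -/
def ucbWeight (τ₀ ζ m : ℕ) (C : A × I → ℝ) (r : ℕ → Ω → A → ℝ) (α : ℕ → Ω → Finset (A × I))
    (n : ℕ) (ω : Ω) (e : A × I) : ℝ :=
  empiricalMean τ₀ ζ r α e n ω + confidence τ₀ ζ m (C e) (pullCount α e n ω) (n + 1)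

/-- The policy `α` is MG-EUCB: in the first `p` epochs feasible matchings are played which contain
every edge exactly once; afterwards a greedy matching for the current weights is played. -/
structure IsMGEUCB [Fintype A] [Fintype I] [DecidableEq κ] (X : Model A I κ Θ)
    (τ₀ ζ m : ℕ) (C : A × I → ℝ) (p : ℕ)
    (r : ℕ → Ω → A → ℝ) (α : ℕ → Ω → Finset (A × I)) : Prop where
  initial_feasible : ∀ ω k, 1 ≤ k → k ≤ p → Feasible X.cls X.cap (α k ω)
  initial_cover : ∀ ω e, ∃! k, (1 ≤ k ∧ k ≤ p) ∧ e ∈ α k ω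
  greedy : ∀ ω n, p ≤ n →
    IsGreedyOutput X.cls X.cap (ucbWeight τ₀ ζ m C r α n ω) (α (n + 1) ω)

end Dynamics

/-- The edge-specific constant `ρ` belonging to the mixing constant `C`. -/
def rho (τ₀ ζ : ℕ) (C : ℝ) : ℝ :=
  ((ζ : ℝ) / ((ζ : ℝ) + τ₀) + 1) * (C / (2 * Real.sqrt ζ))

/-- `4 / Δ² * (ρ / √τ₀ + √(6 log n + 4 log m))²`. -/
def pullBound (τ₀ m n : ℕ) (Δ ρ : ℝ) : ℝ :=
  4 / Δ ^ 2 * (ρ / Real.sqrt τ₀ + Real.sqrt (6 * Real.log n + 4 * Real.log m)) ^ 2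

end MGEUCB

end

open MGEUCB

/-!
Three facts combine to the bound.

*The greedy algorithm is stable* (`IsGreedyBenchmark.greedyEdge_mem`). Of the greedy algorithm only
one property is used: an edge is left out of the output only if the selected edges which are at
least as heavy block it (`IsGreedyOutput.feasible_and_blocked`). It shows that for every edge `f`
that is feasible on its own, other than the heaviest benchmark edge, the gap is positive and there
is a benchmark edge `g_l` with `μ f + Δ f = μ g_l`, where `g_l` is still available to the greedy
algorithm whenever it could wrongly prefer `f` to the next benchmark edge
(`IsGreedyBenchmark.gap_spec`). So if the weights overestimate the means of the benchmark edges, and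
those of the other selected edges by less than the gap, then the output is the benchmark matching.
Hence, in an epoch in which all confidence windows hold, a sub-optimal edge can be played only if
some edge played in that epoch has a confidence window larger than half its gap, which means that it
has been played less than `pullBound` times (`two_mul_confidence_le`,
`IsMGEUCB.exists_pullCount_lt`). Each of at most `m ^ 2` edges accounts for at most `x` such epochs,
where `x` bounds the required numbers of plays (`card_plays_below_le`).

*Epoch rewards are nearly unbiased.* By the Poisson equation of the irreducible chain of an edge, the
expected average reward over `τ` iterations differs from the stationary one by `O(1 / τ)`
(`exists_isMixingConstant`). On an event known at the beginning of an epoch the types of a matched agent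
follow the powers of the transition matrix, so a mixing constant bounds the bias of the epoch reward
(`IsEpochProcess.abs_setIntegral_epochReward_sub_le`), and these biases add up to at most the mixing part
of the confidence window (`sum_bias_le_mixingError`).

*The confidence windows hold.* An exponential supermartingale (`integral_exp_excess_le_one`) yields a
Hoeffding inequality for sums over the random set of epochs in which an edge is played. The window of
epoch `n + 1` fails for some edge with probability at most `1 / n - 1 / (n + 1)`, so over all epochs the
failures cost at most one play in expectation (`IsMGEUCB.integral_pullCount_le`). The initial phase costs
one more.
-/

namespace MGEUCB

/-! ### The greedy algorithm and the gaps -/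

theorem Feasible.mono {A I κ : Type*} [DecidableEq κ] {cls : A × I → κ} {cap : κ → ℕ}
    {M N : Finset (A × I)} (hM : Feasible cls cap M) (h : N ⊆ M) :
    Feasible cls cap N :=
  ⟨fun e he e' he' => hM.1 e (h he) e' (h he'), fun e he e' he' => hM.2.1 e (h he) e' (h he'),
    fun c => (card_le_card (filter_subset_filter _ h)).trans (hM.2.2 c)⟩

section Benchmark

variable {A I : Type*} {m : ℕ} {iStar : A → I} {σ : Fin m ≃ A}

theorem greedyEdge_injective : Function.Injective (greedyEdge iStar σ) := fun _ _ h =>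
  σ.injective (congrArg Prod.fst h)

theorem greedyEdge_symm (a : A) : greedyEdge iStar σ (σ.symm a) = (a, iStar a) := by
  simp [greedyEdge]

theorem mem_benchmark_iff [DecidableEq A] [DecidableEq I] [Fintype A] {e : A × I} :
    e ∈ (univ.image fun a => (a, iStar a)) ↔ ∃ j, greedyEdge iStar σ j = e := by
  simp only [mem_image, mem_univ, true_and]
  constructor
  · rintro ⟨a, rfl⟩
    exact ⟨σ.symm a, greedyEdge_symm a⟩
  · rintro ⟨j, rfl⟩
    exact ⟨σ j, rfl⟩

end Benchmark

section Greedy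

variable {A I κ : Type*} [DecidableEq A] [DecidableEq I] [DecidableEq κ]
  {cls : A × I → κ} {cap : κ → ℕ}

/-- The loop invariant of the greedy algorithm on a state `(G, E)`: `G` is feasible, the edges of `E`
are at most as heavy as those of `G` and disjoint from them, and every edge outside `G` and `E` is
blocked by the edges of `G` that are at least as heavy. -/
theorem GreedyStep.invariant {w : A × I → ℝ} {s s' : Finset (A × I) × Finset (A × I)}
    (h : GreedyStep cls cap w s s')
    (hs : Feasible cls cap s.1 ∧ (∀ f ∈ s.1, ∀ e ∈ s.2, w e ≤ w f ∧ e.1 ≠ f.1 ∧ e.2 ≠ f.2) ∧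
      ∀ e, e ∉ s.1 → e ∉ s.2 → ¬ Feasible cls cap (insert e (s.1.filter fun f => w e ≤ w f))) :
    Feasible cls cap s'.1 ∧ (∀ f ∈ s'.1, ∀ e ∈ s'.2, w e ≤ w f ∧ e.1 ≠ f.1 ∧ e.2 ≠ f.2) ∧
      ∀ e, e ∉ s'.1 → e ∉ s'.2 →
        ¬ Feasible cls cap (insert e (s'.1.filter fun f => w e ≤ w f)) := by
  cases h with
  | accept G E e he hmax hcap =>
    obtain ⟨hF, hlt, hblock⟩ := hs
    refine ⟨⟨?_, ?_, ?_⟩, ?_, ?_⟩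
    · intro x hx y hy hxy
      rcases mem_insert.1 hx with rfl | hx' <;> rcases mem_insert.1 hy with rfl | hy'
      · rfl
      · exact absurd hxy (hlt y hy' x he).2.1
      · exact absurd hxy.symm (hlt x hx' y he).2.1
      · exact hF.1 x hx' y hy' hxy
    · intro x hx y hy hxy
      rcases mem_insert.1 hx with rfl | hx' <;> rcases mem_insert.1 hy with rfl | hy'
      · rfl
      · exact absurd hxy (hlt y hy' x he).2.2
      · exact absurd hxy.symm (hlt x hx' y he).2.2
      · exact hF.2.1 x hx' y hy' hxy
    · intro c
      rw [filter_insert]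
      split_ifs with hc
      · subst hc
        exact (card_insert_le _ _).trans hcap
      · exact hF.2.2 c
    · intro f hf x hx
      obtain ⟨hxE, hx1, hx2⟩ := mem_filter.1 hx
      rcases mem_insert.1 hf with rfl | hf
      · exact ⟨hmax x hxE, hx1, hx2⟩
      · exact hlt f hf x hxE
    · intro x hxG hxE hfeas
      obtain ⟨hxe, hxG⟩ := not_or.1 (mt mem_insert.2 hxG)
      by_cases hx : x ∈ E
      · have hem : e ∈ insert x ((insert e G).filter fun f => w x ≤ w f) :=
          mem_insert_of_mem (mem_filter.2 ⟨mem_insert_self _ _, hmax x hx⟩)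
        refine hxE (mem_filter.2 ⟨hx, fun h => hxe ?_, fun h => hxe ?_⟩)
        · exact hfeas.1 x (mem_insert_self _ _) e hem h
        · exact hfeas.2.1 x (mem_insert_self _ _) e hem h
      · exact hblock x hxG hx (hfeas.mono
          (insert_subset_insert _ (filter_subset_filter _ (subset_insert _ _))))
  | reject G E e he hmax hcap =>
    obtain ⟨hF, hlt, hblock⟩ := hs
    refine ⟨hF, fun f hf x hx => hlt f hf x (mem_of_mem_erase hx), fun x hxG hxE hfeas => ?_⟩
    by_cases hx : x ∈ E
    · obtain rfl : x = e := by
        by_contra hne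
        exact hxE (mem_erase.2 ⟨hne, hx⟩)
      have hG : G.filter (fun f => w x ≤ w f) = G := filter_true_of_mem fun f hf => (hlt f hf x hx).1
      have := hfeas.2.2 (cls x)
      rw [hG, filter_insert, if_pos rfl, card_insert_of_notMem (by simp [hxG])] at this
      omega
    · exact hblock x hxG hx hfeas

/-- A greedy output is feasible, and an edge is left out only because the selected edges that are at
least as heavy block it. No other property of the greedy algorithm is needed. -/
theorem IsGreedyOutput.feasible_and_blocked [Fintype A] [Fintype I] {w : A × I → ℝ}
    {G : Finset (A × I)} (h : IsGreedyOutput cls cap w G) :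
    Feasible cls cap G ∧
      ∀ e ∉ G, ¬ Feasible cls cap (insert e (G.filter fun f => w e ≤ w f)) := by
  suffices H : ∀ s, Relation.ReflTransGen (GreedyStep cls cap w) (∅, Finset.univ) s →
      Feasible cls cap s.1 ∧ (∀ f ∈ s.1, ∀ e ∈ s.2, w e ≤ w f ∧ e.1 ≠ f.1 ∧ e.2 ≠ f.2) ∧
      ∀ e, e ∉ s.1 → e ∉ s.2 → ¬ Feasible cls cap (insert e (s.1.filter fun f => w e ≤ w f)) from
    ⟨(H _ h).1, fun e he => (H _ h).2.2 e he (notMem_empty e)⟩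
  intro s hs
  induction hs with
  | refl => simp [Feasible]
  | tail _ hstep ih => exact hstep.invariant ih

section Benchmark

variable [Fintype A] [Fintype I] {m : ℕ} {iStar : A → I} {σ : Fin m ≃ A} {μ : A × I → ℝ}

/-- The gap of a feasible edge `f` other than the heaviest benchmark edge is positive, and the stationary
reward of `f` plus its gap is that of a benchmark edge `g_l`. If `f` can be added to the benchmark
edges before `g_j`, and is not one of these edges or `g_j` itself, then `g_l` does not come before
`g_j`. -/
theorem IsGreedyBenchmark.gap_spec (hG : IsGreedyBenchmark cls cap μ iStar σ) (hm : 0 < m)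
    {f : A × I} (hf0 : f ≠ greedyEdge iStar σ ⟨0, hm⟩) (hf : Feasible cls cap {f})
    (hgap : gap cls cap μ iStar σ f ≠ 0) :
    0 < gap cls cap μ iStar σ f ∧ ∃ l, μ f + gap cls cap μ iStar σ f = μ (greedyEdge iStar σ l) ∧
      ∀ j, (∀ i ≤ j, f ≠ greedyEdge iStar σ i) →
        Feasible cls cap (insert f ((univ.filter (· < j)).image (greedyEdge iStar σ))) →
        j ≤ l := by
  unfold gap at hgap ⊢
  split_ifs at hgap ⊢ with hS hg hL
  · refine ⟨sub_pos.2 hS, σ.symm f.1, by rw [greedyEdge_symm]; ring, fun j hj hfeas => ?_⟩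
    by_contra! hlt
    refine hj _ hlt.le (hfeas.1 f (mem_insert_self _ _) _ (mem_insert_of_mem ?_) ?_)
    · exact mem_image_of_mem _ (by simpa using hlt)
    · simp [greedyEdge_symm]
  · obtain ⟨hgf, hl⟩ := hg.choose_spec.choose_spec
    set i := hg.choose
    set l := hg.choose_spec.choose
    have hle : μ f ≤ μ (greedyEdge iStar σ l) := by
      rw [← hgf]
      exact hG.sorted (Fin.le_def.2 (by omega))
    refine ⟨lt_of_le_of_ne (sub_nonneg.2 hle) hgap.symm, l, by ring, fun j hj _ => ?_⟩
    by_contra! hlt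
    exact hj i (Fin.le_def.2 (by have := Fin.lt_def.1 hlt; omega)) hgf.symm
  · have hmem := hL.choose_spec
    set l := hL.choose
    have hfG : ∀ i, f ≠ greedyEdge iStar σ i := by
      intro i hi
      rcases Nat.eq_zero_or_pos (i : ℕ) with h0 | hpos
      · exact hf0 (hi.trans (congrArg _ (Fin.ext h0)))
      · exact hg ⟨i, ⟨i - 1, by omega⟩, hi.symm, by simp; omega⟩
    have hle : μ f ≤ μ (greedyEdge iStar σ l) := by
      by_contra! hlt
      have hblock := hG.greedy.feasible_and_blocked.2 f
        (fun h => let ⟨i, hi⟩ := (mem_benchmark_iff (σ := σ)).1 h; hfG i hi.symm)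
      rcases Nat.eq_zero_or_pos (l : ℕ) with h0 | hpos
      · refine hblock (hf.mono fun x hx => ?_)
        rcases mem_insert.1 hx with rfl | hx
        · simp
        · obtain ⟨hx, hxf⟩ := mem_filter.1 hx
          obtain ⟨i, rfl⟩ := (mem_benchmark_iff (σ := σ)).1 hx
          have := hG.sorted (show l ≤ i from Fin.le_def.2 (by omega))
          exact absurd (hlt.trans_le hxf) (not_lt.2 this)
      · refine hmem.2 ⟨l - 1, by omega⟩ (by simp; omega) fun hfeas => hblock (hfeas.mono ?_)
        refine insert_subset_insert _ fun x hx => ?_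
        obtain ⟨hx, hxf⟩ := mem_filter.1 hx
        obtain ⟨i, rfl⟩ := (mem_benchmark_iff (σ := σ)).1 hx
        refine mem_image_of_mem _ (mem_filter.2 ⟨mem_univ _, ?_⟩)
        by_contra! hli
        have hli' := Fin.lt_def.1 hli
        simp only at hli'
        have := hG.sorted (show l ≤ i from Fin.le_def.2 (by omega))
        exact absurd (hlt.trans_le hxf) (not_lt.2 this)
    refine ⟨lt_of_le_of_ne (sub_nonneg.2 hle) hgap.symm, l, by ring, fun j _ hfeas => ?_⟩
    by_contra! hlt
    refine hmem.1 (hfeas.mono (insert_subset_insert _ (image_subset_image fun i hi => ?_)))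
    simp only [mem_filter, mem_univ, true_and] at hi ⊢
    exact hi.trans_lt hlt
  · exact absurd rfl hgap

/-- If the weights overestimate the stationary rewards of the benchmark edges, and those of the other
selected edges by less than their gaps, then the greedy algorithm finds the benchmark matching. -/
theorem IsGreedyBenchmark.greedyEdge_mem (hG : IsGreedyBenchmark cls cap μ iStar σ) (hm : 0 < m)
    (hΔ : ∀ e, e ≠ greedyEdge iStar σ ⟨0, hm⟩ → gap cls cap μ iStar σ e ≠ 0)
    {w : A × I → ℝ} {G : Finset (A × I)} (hGw : IsGreedyOutput cls cap w G)
    (hlow : ∀ l, μ (greedyEdge iStar σ l) ≤ w (greedyEdge iStar σ l))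
    (hup : ∀ f ∈ G, f ≠ greedyEdge iStar σ ⟨0, hm⟩ → w f < μ f + gap cls cap μ iStar σ f) (j : Fin m) :
    greedyEdge iStar σ j ∈ G := by
  obtain ⟨hF, hblock⟩ := hGw.feasible_and_blocked
  have hGs := hG.greedy.feasible_and_blocked.1
  induction j using WellFoundedLT.induction with
  | ind j ih =>
  by_contra hjG
  have hpre : (univ.filter (· < j)).image (greedyEdge iStar σ) ⊆ G := by
    intro x hx
    obtain ⟨i, hi, rfl⟩ := mem_image.1 hx
    exact ih i (mem_filter.1 hi).2
  -- A benchmark edge is in `G` unless some selected edge outside the prefix is at least as heavy.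
  have hsel : ∀ l, (∀ f ∈ G, (∀ i < j, f ≠ greedyEdge iStar σ i) →
      w f < w (greedyEdge iStar σ l)) → greedyEdge iStar σ l ∈ G := by
    intro l hl
    by_contra hlG
    refine hblock _ hlG (hGs.mono fun x hx => (mem_benchmark_iff (σ := σ)).2 ?_)
    rcases mem_insert.1 hx with rfl | hx
    · exact ⟨l, rfl⟩
    · obtain ⟨hx, hxw⟩ := mem_filter.1 hx
      by_contra! hne
      exact absurd (hl x hx fun i _ => (hne i).symm) (not_lt.2 hxw)
  set Q := G.filter fun f => ∀ i < j, f ≠ greedyEdge iStar σ i with hQ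
  have hQne : Q.Nonempty := by
    rw [nonempty_iff_ne_empty]
    intro h
    refine hjG (hsel j fun f hf hfi => ?_)
    have : f ∈ Q := mem_filter.2 ⟨hf, hfi⟩
    simp [h] at this
  obtain ⟨f, hfQ, hmax⟩ := exists_max_image Q w hQne
  obtain ⟨hfG, hfi⟩ := mem_filter.1 hfQ
  have hfj : ∀ i ≤ j, f ≠ greedyEdge iStar σ i := by
    intro i hi
    rcases hi.lt_or_eq with h | rfl
    · exact hfi i h
    · rintro rfl
      exact hjG hfG
  have hf0 : f ≠ greedyEdge iStar σ ⟨0, hm⟩ := hfj _ (Fin.le_def.2 (Nat.zero_le _))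
  obtain ⟨-, l, hl, hjl⟩ := hG.gap_spec hm hf0 (hF.mono (singleton_subset_iff.2 hfG)) (hΔ f hf0)
  have hjl := hjl j hfj (hF.mono (insert_subset hfG hpre))
  have hlt : w f < w (greedyEdge iStar σ l) :=
    (hup f hfG hf0).trans_le (hl.le.trans (hlow l))
  have hlG := hsel l fun f' hf' hfi' => (hmax f' (mem_filter.2 ⟨hf', hfi'⟩)).trans_lt hlt
  refine absurd (hmax _ (mem_filter.2 ⟨hlG, fun i hi h => ?_⟩)) (not_le.2 hlt)
  exact absurd (greedyEdge_injective h) (hi.trans_le hjl).ne'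

end Benchmark

end Greedy

/-! ### Mixing constants of irreducible chains -/

section Mixing

open Matrix

variable {S : Type*} [Fintype S] [DecidableEq S] {P : Matrix S S ℝ}

/-- The maximum principle: a harmonic function of an irreducible chain is constant. -/
theorem eq_of_mulVec_eq_self (hP : P ∈ rowStochastic ℝ S) (hirr : P.IsIrreducible) {h : S → ℝ}
    (hh : P *ᵥ h = h) (i j : S) : h i = h j := by
  have : Nonempty S := ⟨i⟩
  obtain ⟨s, hs⟩ := Finite.exists_max h
  have key : ∀ j, h j = h s := by
    intro j
    obtain ⟨k, -, hk⟩ := (isIrreducible_iff_exists_pow_pos hirr.nonneg).1 hirr s j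
    have hPk : P ^ k ∈ rowStochastic ℝ S := pow_mem hP k
    have hfix : (P ^ k) *ᵥ h = h := by
      clear hk hPk
      induction k with
      | zero => simp
      | succ k ih => rw [pow_succ, ← mulVec_mulVec, hh, ih]
    have hsum : ∑ x, (P ^ k) s x * (h s - h x) = 0 := by
      have := congrFun hfix s
      simp only [mulVec, dotProduct] at this
      simp only [mul_sub, sum_sub_distrib, ← sum_mul, sum_row_of_mem_rowStochastic hPk, this]
      ring
    have h0 := (sum_eq_zero_iff_of_nonneg fun x _ => mul_nonneg
      (nonneg_of_mem_rowStochastic hPk) (sub_nonneg.2 (hs x))).1 hsum j (mem_univ _)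
    have := (mul_eq_zero.1 h0).resolve_left hk.ne'
    linarith
  rw [key i, key j]

/-- The Poisson equation `h - P h = f` has a solution for every `f` with stationary mean zero: the
range of `1 - P` is contained in the hyperplane orthogonal to `π`, and it has the same dimension, as
the kernel of `1 - P` consists of the constants. -/
theorem exists_poisson_solution (hP : P ∈ rowStochastic ℝ S) (hirr : P.IsIrreducible) {π : S → ℝ}
    (hπ : IsStationaryDist P π) {f : S → ℝ} (hf : π ⬝ᵥ f = 0) : ∃ h : S → ℝ, h - P *ᵥ h = f := by
  set L : (S → ℝ) →ₗ[ℝ] (S → ℝ) := LinearMap.id - P.mulVecLin with hL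
  set φ : (S → ℝ) →ₗ[ℝ] ℝ := dotProductBilin ℝ ℝ π with hφ
  have hle : LinearMap.range L ≤ LinearMap.ker φ := by
    rintro _ ⟨h, rfl⟩
    simp [hL, hφ, dotProduct_sub, dotProduct_mulVec, hπ.2]
  have hker : Module.finrank ℝ (LinearMap.ker L) ≤ 1 := by
    have : LinearMap.ker L ≤ Submodule.span ℝ {(1 : S → ℝ)} := by
      intro h hh
      have hfix : P *ᵥ h = h := by
        have : h - P *ᵥ h = 0 := hh
        exact (sub_eq_zero.1 this).symm
      rcases isEmpty_or_nonempty S with hS | ⟨⟨s⟩⟩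
      · simp [Subsingleton.elim h 0]
      · refine Submodule.mem_span_singleton.2 ⟨h s, funext fun x => ?_⟩
        simp [eq_of_mulVec_eq_self hP hirr hfix x s]
    exact (Submodule.finrank_mono this).trans
      ((finrank_span_le_card _).trans (by simp))
  have hφr : 1 ≤ Module.finrank ℝ (LinearMap.range φ) := by
    rw [Nat.one_le_iff_ne_zero, Ne, Submodule.finrank_eq_zero, LinearMap.range_eq_bot]
    intro h0
    have : φ 1 = 0 := by rw [h0]; rfl
    have h1 : ∑ s, π s = 1 := hπ.1.2
    simp [hφ, dotProduct, h1] at this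
  have h1 := L.finrank_range_add_finrank_ker
  have h2 := φ.finrank_range_add_finrank_ker
  have heq := Submodule.eq_of_le_of_finrank_le hle (by omega)
  have : f ∈ LinearMap.range L := by
    rw [heq]
    exact hf
  exact this

/-- Every edge has a mixing constant: by the Poisson equation the deviations from the stationary
mean telescope. -/
theorem exists_isMixingConstant (hP : P ∈ rowStochastic ℝ S) (hirr : P.IsIrreducible) {π : S → ℝ}
    (hπ : IsStationaryDist P π) (f : S → ℝ) : ∃ c, IsMixingConstant P f (∑ s, π s * f s) c := by
  set μ := ∑ s, π s * f s with hμ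
  obtain ⟨h, hh⟩ := exists_poisson_solution (f := fun s => f s - μ) hP hirr hπ (by
    have h1 : ∑ s, π s = 1 := hπ.1.2
    simp [dotProduct, mul_sub, sum_sub_distrib, ← sum_mul, h1, hμ])
  obtain ⟨K, hK⟩ : ∃ K, ∀ s, |h s| ≤ K := by
    refine ⟨∑ s, |h s|, fun s => single_le_sum (f := fun s => |h s|)
      (fun _ _ => abs_nonneg _) (mem_univ s)⟩
  refine ⟨4 * |K| + 1, by positivity, fun τ hτ s => ?_⟩
  have hτ0 : (0 : ℝ) < τ := by exact_mod_cast hτ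
  have hpow : ∀ t, P ^ t ∈ rowStochastic ℝ S := fun t => pow_mem hP t
  have htel : ∀ τ : ℕ, ∑ t ∈ range τ, ∑ s', (P ^ t) s s' * f s' - τ * μ
      = h s - ((P ^ τ) *ᵥ h) s := by
    intro τ
    induction τ with
    | zero => simp
    | succ τ ih =>
      have hstep : ∑ s', (P ^ τ) s s' * f s' - μ = ((P ^ τ) *ᵥ h) s - ((P ^ (τ + 1)) *ᵥ h) s := by
        rw [pow_succ, ← mulVec_mulVec, ← Pi.sub_apply, ← mulVec_sub, hh]
        simp [mulVec, dotProduct, mul_sub, sum_sub_distrib, ← sum_mul,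
          sum_row_of_mem_rowStochastic (hpow τ)]
      rw [sum_range_succ]
      push_cast
      linarith
  have hbd : |((P ^ τ) *ᵥ h) s| ≤ |K| := by
    calc |((P ^ τ) *ᵥ h) s| ≤ ∑ x, |(P ^ τ) s x * h x| := abs_sum_le_sum_abs _ _
      _ ≤ ∑ x, (P ^ τ) s x * |K| := by
          refine sum_le_sum fun x _ => ?_
          rw [abs_mul, abs_of_nonneg (nonneg_of_mem_rowStochastic (hpow τ))]
          exact mul_le_mul_of_nonneg_left ((hK x).trans (le_abs_self K))
            (nonneg_of_mem_rowStochastic (hpow τ))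
      _ = |K| := by rw [← sum_mul, sum_row_of_mem_rowStochastic (hpow τ), one_mul]
  have hs := (hK s).trans (le_abs_self K)
  have hdev := htel τ
  have heq : μ - 1 / (τ : ℝ) * ∑ t ∈ range τ, ∑ s', (P ^ t) s s' * f s'
      = -(h s - ((P ^ τ) *ᵥ h) s) / τ := by
    rw [← hdev]
    field_simp
    ring
  rw [heq, abs_div, abs_neg, abs_of_pos hτ0, div_le_div_iff₀ hτ0 (by positivity)]
  have := abs_sub (h s) (((P ^ τ) *ᵥ h) s)
  nlinarith

end Mixing

/-! ### Hoeffding's inequality for sums over random times -/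

section Concentration

/-- Hoeffding's bound on the moment generating function of a Bernoulli variable. -/
theorem one_add_exp_sub_one_mul_le {q : ℝ} (h0 : 0 ≤ q) (h1 : q ≤ 1) (t : ℝ) :
    1 + (Real.exp t - 1) * q ≤ Real.exp (t * q + t ^ 2 / 8) := by
  set ν : Measure ℝ := ENNReal.ofReal q • Measure.dirac 1 + ENNReal.ofReal (1 - q) • Measure.dirac 0
    with hν
  have hint : ∀ f : ℝ → ℝ, ∫ x, f x ∂ν = q * f 1 + (1 - q) * f 0 := by
    intro f
    have hd : ∀ a : ℝ, Integrable f (Measure.dirac a) := fun a =>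
      integrable_dirac (by simp)
    rw [hν, integral_add_measure ((hd 1).smul_measure (by simp)) ((hd 0).smul_measure (by simp)),
      integral_smul_measure, integral_smul_measure, integral_dirac, integral_dirac,
      ENNReal.toReal_ofReal h0, ENNReal.toReal_ofReal (by linarith)]
    simp
  have : IsProbabilityMeasure ν := ⟨by
    simp only [hν, Measure.add_apply, Measure.smul_apply, measure_univ, smul_eq_mul, mul_one]
    rw [← ENNReal.ofReal_add h0 (by linarith)]
    simp⟩
  have hae : ∀ᵐ x ∂ν, id x ∈ Set.Icc (0 : ℝ) 1 := by
    rw [ae_iff, hν]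
    simp [Measure.dirac_apply]
  have hsub := (hasSubgaussianMGF_of_mem_Icc (μ := ν) aemeasurable_id hae).mgf_le t
  have hmean : ∫ x, id x ∂ν = q := by rw [hint]; simp
  simp only [mgf, hmean] at hsub
  rw [hint] at hsub
  simp only [id, zero_sub] at hsub
  have e1 : Real.exp (t * (1 - q)) = Real.exp t * Real.exp (-(t * q)) := by
    rw [← Real.exp_add]; ring_nf
  have e0 : Real.exp (t * -q) = Real.exp (-(t * q)) := by ring_nf
  rw [e1, e0] at hsub
  have hc : (((‖(1 : ℝ) - 0‖₊ / 2) ^ 2 : NNReal) : ℝ) * t ^ 2 / 2 = t ^ 2 / 8 := by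
    simp
    ring
  rw [hc] at hsub
  calc 1 + (Real.exp t - 1) * q
      = (q * (Real.exp t * Real.exp (-(t * q))) + (1 - q) * Real.exp (-(t * q)))
          * Real.exp (t * q) := by
        have : Real.exp (-(t * q)) * Real.exp (t * q) = 1 := by rw [← Real.exp_add]; simp
        linear_combination (-(q * Real.exp t + (1 - q))) * this
    _ ≤ Real.exp (t ^ 2 / 8) * Real.exp (t * q) :=
        mul_le_mul_of_nonneg_right hsub (Real.exp_pos _).le
    _ = Real.exp (t * q + t ^ 2 / 8) := by rw [← Real.exp_add]; ring_nf

variable {Ω : Type*} {mΩ : MeasurableSpace Ω} {Pr : Measure Ω} [IsProbabilityMeasure Pr]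

/-- If `Y` has conditional mean at most `q` on `A`, then `q` may replace `Y` on `A` under an integral
against a nonnegative weight known beforehand. -/
theorem setIntegral_mul_le {𝓂 : MeasurableSpace Ω} (hm : 𝓂 ≤ mΩ) {A : Set Ω}
    (hA : MeasurableSet[𝓂] A) {Z Y : Ω → ℝ} {K q : ℝ} (hZ : StronglyMeasurable[𝓂] Z)
    (hZ0 : ∀ ω, 0 ≤ Z ω) (hZK : ∀ ω, Z ω ≤ K) (hY : Measurable[mΩ] Y)
    (hY01 : ∀ ω, Y ω ∈ Set.Icc (0 : ℝ) 1)
    (hmean : ∀ G, MeasurableSet[𝓂] G → G ⊆ A → ∫ ω in G, Y ω ∂Pr ≤ q * Pr.real G) :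
    ∫ ω in A, Z ω * Y ω ∂Pr ≤ q * ∫ ω in A, Z ω ∂Pr := by
  have hYi : Integrable Y Pr := Integrable.of_mem_Icc 0 1 hY.aemeasurable (ae_of_all _ hY01)
  have hZi : Integrable Z Pr := Integrable.of_mem_Icc 0 K (hZ.mono hm).measurable.aemeasurable
    (ae_of_all _ fun ω => ⟨hZ0 ω, hZK ω⟩)
  have hZb : ∀ᵐ ω ∂Pr, ‖Z ω‖ ≤ K := ae_of_all _ fun ω => by
    rw [Real.norm_of_nonneg (hZ0 ω)]; exact hZK ω
  have hZYi : Integrable (Z * Y) Pr := hYi.bdd_mul hZi.aestronglyMeasurable hZb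
  have hpull := condExp_stronglyMeasurable_mul_of_bound hm hZ hYi K hZb
  have hZgi : Integrable (fun ω => Z ω * (Pr[Y|𝓂]) ω) Pr :=
    integrable_condExp.bdd_mul hZi.aestronglyMeasurable hZb
  have h1 : ∫ ω in A, Z ω * Y ω ∂Pr = ∫ ω in A, Z ω * (Pr[Y|𝓂]) ω ∂Pr := by
    exact (setIntegral_condExp hm hZYi hA).symm.trans
      (setIntegral_congr_ae (hm _ hA) (hpull.mono fun ω h _ => h))
  have hg : ∀ᵐ ω ∂Pr, ω ∈ A → (Pr[Y|𝓂]) ω ≤ q := by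
    set G : Set Ω := A ∩ {ω | q < (Pr[Y|𝓂]) ω} with hG
    have hGm : MeasurableSet[𝓂] G :=
      hA.inter (stronglyMeasurable_condExp.measurable measurableSet_Ioi)
    have hle : ∫ ω in G, ((Pr[Y|𝓂]) ω - q) ∂Pr ≤ 0 := by
      rw [integral_sub integrable_condExp.integrableOn (integrable_const _).integrableOn,
        setIntegral_condExp hm hYi hGm, setIntegral_const, smul_eq_mul]
      linarith [hmean G hGm Set.inter_subset_left]
    have hzero : Pr G = 0 := by
      by_contra hne
      refine absurd hle (not_le.2 ?_)
      refine (setIntegral_pos_iff_support_of_nonneg_ae ?_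
        (integrable_condExp.sub (integrable_const _)).integrableOn).2 ?_
      · exact (ae_restrict_iff' (hm _ hGm)).2 (ae_of_all _ fun ω h => (sub_pos.2 h.2).le)
      · refine (pos_iff_ne_zero.2 hne).trans_le (measure_mono fun ω h => ⟨?_, h⟩)
        exact (sub_pos.2 h.2).ne'
    filter_upwards [measure_eq_zero_iff_ae_notMem.1 hzero] with ω hω hωA
    by_contra! h
    exact hω ⟨hωA, h⟩
  rw [h1, ← integral_const_mul]
  refine setIntegral_mono_ae_restrict hZgi.integrableOn (hZi.const_mul q).integrableOn ?_
  refine (ae_restrict_iff' (hm _ hA)).2 (hg.mono fun ω h hω => ?_)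
  simp only
  nlinarith [h hω, hZ0 ω]

variable {𝒢 : Filtration ℕ mΩ} {E : ℕ → Set Ω} {Y : ℕ → Ω → ℝ} {q : ℕ → ℝ}

open Classical in
/-- The sum over the times `1 ≤ k ≤ n` at which `E k` occurs of the excess `Y k - q k`. -/
noncomputable def excess (E : ℕ → Set Ω) (Y : ℕ → Ω → ℝ) (q : ℕ → ℝ) (n : ℕ) (ω : Ω) : ℝ :=
  ∑ k ∈ (Icc 1 n).filter (fun k => ω ∈ E k), (Y k ω - q k)

open Classical in
/-- The number of the times `1 ≤ k ≤ n` at which `E k` occurs. -/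
noncomputable def occurrences (E : ℕ → Set Ω) (n : ℕ) (ω : Ω) : ℕ :=
  ((Icc 1 n).filter (fun k => ω ∈ E k)).card

theorem occurrences_succ (n : ℕ) (ω : Ω) : occurrences E (n + 1) ω =
    occurrences E n ω + (E (n + 1)).indicator 1 ω := by
  classical
  unfold occurrences
  rw [← insert_Icc_right_eq_Icc_add_one (by omega : 1 ≤ n + 1), filter_insert]
  split_ifs with h
  · rw [card_insert_of_notMem (by simp)]
    simp [h]
  · simp [h]

theorem excess_succ (n : ℕ) (ω : Ω) : excess E Y q (n + 1) ω =
    excess E Y q n ω + (E (n + 1)).indicator (fun ω => Y (n + 1) ω - q (n + 1)) ω := by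
  classical
  unfold excess
  rw [← insert_Icc_right_eq_Icc_add_one (by omega : 1 ≤ n + 1), filter_insert]
  split_ifs with h
  · rw [sum_insert (by simp)]
    simp [h, add_comm]
  · simp [h]

theorem measurable_excess (hE : ∀ k, 1 ≤ k → MeasurableSet[𝒢 k] (E k))
    (hY : ∀ k, 1 ≤ k → Measurable[𝒢 (k + 1)] (Y k)) (n : ℕ) :
    Measurable[𝒢 (n + 1)] (excess E Y q n) := by
  induction n with
  | zero =>
    have : excess E Y q 0 = fun _ => 0 := by funext ω; simp [excess]
    rw [this]
    exact @measurable_const _ _ _ (𝒢 (0 + 1)) _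
  | succ n ih =>
    have : excess E Y q (n + 1) = fun ω => excess E Y q n ω +
        (E (n + 1)).indicator (fun ω => Y (n + 1) ω - q (n + 1)) ω := funext (excess_succ n)
    rw [this]
    have h1 := ih.mono (𝒢.mono (Nat.le_succ (n + 1))) le_rfl
    refine h1.add (Measurable.indicator ((hY (n + 1) (by omega)).sub_const _) ?_)
    exact 𝒢.mono (Nat.le_succ (n + 1)) _ (hE (n + 1) (by omega))

theorem measurable_occurrences (hE : ∀ k, 1 ≤ k → MeasurableSet[𝒢 k] (E k)) (n : ℕ) :
    Measurable[𝒢 (n + 1)] (occurrences E n) := by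
  induction n with
  | zero =>
    have : occurrences E 0 = fun _ => 0 := by funext ω; simp [occurrences]
    rw [this]
    exact @measurable_const _ _ _ (𝒢 (0 + 1)) _
  | succ n ih =>
    have : occurrences E (n + 1) = fun ω => occurrences E n ω + (E (n + 1)).indicator 1 ω :=
      funext (occurrences_succ n)
    rw [this]
    have h1 := ih.mono (𝒢.mono (Nat.le_succ (n + 1))) le_rfl
    refine h1.add (Measurable.indicator (@measurable_const _ _ _ (𝒢 (n + 1 + 1)) _) ?_)
    exact 𝒢.mono (Nat.le_succ (n + 1)) _ (hE (n + 1) (by omega))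

theorem occurrences_le (n : ℕ) (ω : Ω) : occurrences E n ω ≤ n := by
  classical
  exact (card_filter_le _ _).trans (by simp)

theorem excess_le (hY1 : ∀ k ω, Y k ω ≤ 1) (hq0 : ∀ k, 0 ≤ q k) (n : ℕ) (ω : Ω) :
    excess E Y q n ω ≤ n := by
  refine (sum_le_card_nsmul _ _ 1 fun k _ => ?_).trans ?_
  · linarith [hY1 k ω, hq0 k]
  · rw [nsmul_one]
    exact_mod_cast occurrences_le n ω

/-- The exponential supermartingale of the excess, with Hoeffding's variance proxy. -/
theorem integral_exp_excess_le_one (hE : ∀ k, 1 ≤ k → MeasurableSet[𝒢 k] (E k))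
    (hY : ∀ k, 1 ≤ k → Measurable[𝒢 (k + 1)] (Y k)) (hY01 : ∀ k ω, Y k ω ∈ Set.Icc (0 : ℝ) 1)
    (hq : ∀ k, q k ∈ Set.Icc (0 : ℝ) 1)
    (hmean : ∀ k, 1 ≤ k → ∀ G, MeasurableSet[𝒢 k] G → G ⊆ E k →
      ∫ ω in G, Y k ω ∂Pr ≤ q k * Pr.real G) {t : ℝ} (ht : 0 ≤ t) (n : ℕ) :
    ∫ ω, Real.exp (t * excess E Y q n ω - t ^ 2 / 8 * occurrences E n ω) ∂Pr ≤ 1 := by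
  set Z : ℕ → Ω → ℝ := fun n ω =>
    Real.exp (t * excess E Y q n ω - t ^ 2 / 8 * occurrences E n ω) with hZdef
  have hZm : ∀ n, Measurable[𝒢 (n + 1)] (Z n) := by
    intro n
    have h1 := measurable_excess (q := q) hE hY n
    have h2 := (measurable_of_countable (fun k : ℕ => (k : ℝ))).comp
      (measurable_occurrences hE n)
    exact Real.measurable_exp.comp ((h1.const_mul t).sub (h2.const_mul (t ^ 2 / 8)))
  have hZ0 : ∀ n ω, 0 ≤ Z n ω := fun n ω => (Real.exp_pos _).le
  have hZK : ∀ n ω, Z n ω ≤ Real.exp (t * n) := by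
    intro n ω
    refine Real.exp_le_exp.2 ?_
    have h1 := mul_le_mul_of_nonneg_left
      (excess_le (E := E) (fun k ω => (hY01 k ω).2) (fun k => (hq k).1) n ω) ht
    have h2 : 0 ≤ t ^ 2 / 8 * (occurrences E n ω : ℝ) := by positivity
    linarith
  have hZi : ∀ n, Integrable (Z n) Pr := fun n => Integrable.of_mem_Icc 0 _
    ((hZm n).mono (𝒢.le _) le_rfl).aemeasurable (ae_of_all _ fun ω => ⟨hZ0 n ω, hZK n ω⟩)
  change ∫ ω, Z n ω ∂Pr ≤ 1
  induction n with
  | zero => simp [hZdef, excess, occurrences]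
  | succ n ih =>
    refine le_trans ?_ ih
    have hEm : MeasurableSet (E (n + 1)) := 𝒢.le _ _ (hE (n + 1) (by omega))
    rw [← integral_add_compl hEm (hZi (n + 1)), ← integral_add_compl hEm (hZi n)]
    refine add_le_add ?_ (le_of_eq ?_)
    swap
    · refine setIntegral_congr_fun hEm.compl fun ω hω => ?_
      simp only [hZdef, excess_succ, occurrences_succ]
      rw [Set.indicator_of_notMem hω, Set.indicator_of_notMem hω]
      simp
    set c := Real.exp (-(t * q (n + 1) + t ^ 2 / 8)) with hc
    have hYi : Integrable (fun ω => Z n ω * Y (n + 1) ω) Pr := by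
      refine Integrable.bdd_mul (c := Real.exp (t * n)) ?_ (hZi n).aestronglyMeasurable
        (ae_of_all _ fun ω => ?_)
      · exact Integrable.of_mem_Icc 0 1
          ((hY (n + 1) (by omega)).mono (𝒢.le _) le_rfl).aemeasurable (ae_of_all _ (hY01 _))
      · rw [Real.norm_of_nonneg (hZ0 n ω)]
        exact hZK n ω
    have hbound : ∀ ω ∈ E (n + 1), Z (n + 1) ω ≤
        c * Z n ω + c * (Real.exp t - 1) * (Z n ω * Y (n + 1) ω) := by
      intro ω hω
      have hsplit : Z (n + 1) ω = Z n ω * (c * Real.exp (t * Y (n + 1) ω)) := by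
        simp only [hZdef, excess_succ, occurrences_succ, hc, ← Real.exp_add]
        rw [Set.indicator_of_mem hω, Set.indicator_of_mem hω]
        simp only [Pi.one_apply]
        push_cast
        ring_nf
      -- the chord of `exp` over `[0, t]`
      have hconv : Real.exp (t * Y (n + 1) ω) ≤ 1 + (Real.exp t - 1) * Y (n + 1) ω := by
        have := convexOn_exp.2 (Set.mem_univ 0) (Set.mem_univ t)
          (sub_nonneg.2 (hY01 (n + 1) ω).2) (hY01 (n + 1) ω).1 (by ring)
        simp only [smul_eq_mul, mul_zero, zero_add, Real.exp_zero, mul_one] at this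
        rw [mul_comm t]
        linarith
      rw [hsplit]
      have := mul_le_mul_of_nonneg_left hconv (mul_nonneg (hZ0 n ω) (Real.exp_pos _).le :
        0 ≤ Z n ω * c)
      linarith
    have hstep := setIntegral_mul_le (Pr := Pr) (𝒢.le (n + 1)) (hE (n + 1) (by omega))
      (hZm n).stronglyMeasurable (hZ0 n) (hZK n)
      ((hY (n + 1) (by omega)).mono (𝒢.le _) le_rfl) (hY01 _) (hmean (n + 1) (by omega))
    calc ∫ ω in E (n + 1), Z (n + 1) ω ∂Pr
        ≤ ∫ ω in E (n + 1), (c * Z n ω + c * (Real.exp t - 1) * (Z n ω * Y (n + 1) ω)) ∂Pr :=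
          setIntegral_mono_on (hZi _).integrableOn
            (((hZi n).const_mul c).add (hYi.const_mul _)).integrableOn hEm hbound
      _ = c * ∫ ω in E (n + 1), Z n ω ∂Pr
          + c * (Real.exp t - 1) * ∫ ω in E (n + 1), Z n ω * Y (n + 1) ω ∂Pr := by
          rw [integral_add ((hZi n).const_mul c).integrableOn (hYi.const_mul _).integrableOn,
            integral_const_mul, integral_const_mul]
      _ ≤ c * (1 + (Real.exp t - 1) * q (n + 1)) * ∫ ω in E (n + 1), Z n ω ∂Pr := by
          have h1 : 0 ≤ c * (Real.exp t - 1) :=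
            mul_nonneg (Real.exp_pos _).le (sub_nonneg.2 (Real.one_le_exp ht))
          have := mul_le_mul_of_nonneg_left hstep h1
          linarith
      _ ≤ 1 * ∫ ω in E (n + 1), Z n ω ∂Pr := by
          refine mul_le_mul_of_nonneg_right ?_ (integral_nonneg (hZ0 n))
          have := mul_le_mul_of_nonneg_left (one_add_exp_sub_one_mul_le (hq (n + 1)).1
            (hq (n + 1)).2 t) (Real.exp_pos (-(t * q (n + 1) + t ^ 2 / 8))).le
          rwa [← Real.exp_add, neg_add_cancel, Real.exp_zero] at this
      _ = _ := one_mul _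

/-- Hoeffding's inequality for a sum over randomly many times: the probability that `j` occurrences
have been seen by time `n`, with an excess of at least `j ε`. -/
theorem measureReal_excess_ge_le (hE : ∀ k, 1 ≤ k → MeasurableSet[𝒢 k] (E k))
    (hY : ∀ k, 1 ≤ k → Measurable[𝒢 (k + 1)] (Y k)) (hY01 : ∀ k ω, Y k ω ∈ Set.Icc (0 : ℝ) 1)
    (hq : ∀ k, q k ∈ Set.Icc (0 : ℝ) 1)
    (hmean : ∀ k, 1 ≤ k → ∀ G, MeasurableSet[𝒢 k] G → G ⊆ E k →
      ∫ ω in G, Y k ω ∂Pr ≤ q k * Pr.real G) {ε : ℝ} (hε : 0 ≤ ε) (n j : ℕ) :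
    Pr.real {ω | occurrences E n ω = j ∧ j * ε ≤ excess E Y q n ω} ≤
      Real.exp (-(2 * j * ε ^ 2)) := by
  set Z : Ω → ℝ := fun ω =>
    Real.exp (4 * ε * excess E Y q n ω - (4 * ε) ^ 2 / 8 * occurrences E n ω) with hZ
  have hint : Integrable Z Pr := by
    have h1 := (measurable_excess (q := q) hE hY n).mono (𝒢.le _) le_rfl
    have h2 := (measurable_of_countable (fun k : ℕ => (k : ℝ))).comp
      ((measurable_occurrences hE n).mono (𝒢.le _) le_rfl)
    refine Integrable.of_mem_Icc 0 (Real.exp (4 * ε * n)) (Real.measurable_exp.comp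
      ((h1.const_mul _).sub (h2.const_mul _))).aemeasurable
      (ae_of_all _ fun ω => ⟨(Real.exp_pos _).le, Real.exp_le_exp.2 ?_⟩)
    have h3 := mul_le_mul_of_nonneg_left
      (excess_le (E := E) (fun k ω => (hY01 k ω).2) (fun k => (hq k).1) n ω)
      (by positivity : 0 ≤ 4 * ε)
    have h4 : 0 ≤ (4 * ε) ^ 2 / 8 * (occurrences E n ω : ℝ) := by positivity
    change 4 * ε * excess E Y q n ω - (4 * ε) ^ 2 / 8 * (occurrences E n ω : ℝ) ≤ 4 * ε * n
    linarith
  have hmarkov := mul_meas_ge_le_integral_of_nonneg (μ := Pr) (f := Z)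
    (ae_of_all _ fun ω => (Real.exp_pos _).le) hint (Real.exp (2 * j * ε ^ 2))
  have hone := integral_exp_excess_le_one (Pr := Pr) hE hY hY01 hq hmean
    (by positivity : 0 ≤ 4 * ε) n
  have hsub : {ω | occurrences E n ω = j ∧ j * ε ≤ excess E Y q n ω} ⊆
      {ω | Real.exp (2 * j * ε ^ 2) ≤ Z ω} := by
    rintro ω ⟨h1, h2⟩
    refine Real.exp_le_exp.2 ?_
    rw [h1]
    have := mul_le_mul_of_nonneg_left h2 (by positivity : 0 ≤ 4 * ε)
    nlinarith
  have hpos := Real.exp_pos (2 * j * ε ^ 2)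
  rw [Real.exp_neg, ← one_div, le_div_iff₀ hpos, mul_comm]
  exact (mul_le_mul_of_nonneg_left (measureReal_mono hsub) hpos.le).trans (hmarkov.trans hone)

end Concentration

/-! ### Types and rewards within an epoch -/

section EpochTimes

theorem epochStart_succ (τ₀ ζ : ℕ) {k : ℕ} (hk : 1 ≤ k) :
    epochStart τ₀ ζ (k + 1) = epochStart τ₀ ζ k + epochLength τ₀ ζ k :=
  sum_Ico_succ_top hk _

theorem epochStart_mono (τ₀ ζ : ℕ) : Monotone (epochStart τ₀ ζ) := fun _ _ h =>
  sum_le_sum_of_subset (Ico_subset_Ico le_rfl h)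

end EpochTimes

section EpochDynamics

theorem setIntegral_eq_sum_fibers {Ω S : Type*} {mΩ : MeasurableSpace Ω} {Pr : Measure Ω}
    [IsFiniteMeasure Pr] [Fintype S] {g : Ω → S} (hg : ∀ s, MeasurableSet {ω | g ω = s}) {G : Set Ω}
    (hG : MeasurableSet G) {f : Ω → ℝ} (hf : IntegrableOn f G Pr) :
    ∫ ω in G, f ω ∂Pr = ∑ s, ∫ ω in G ∩ {ω | g ω = s}, f ω ∂Pr := by
  have hU : G = ⋃ s, G ∩ {ω | g ω = s} := by
    ext ω
    simp
  conv_lhs => rw [hU]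
  refine integral_iUnion_fintype (fun s => hG.inter (hg s)) ?_ fun s =>
    hf.mono_set Set.inter_subset_left
  intro s s' hs
  rw [Function.onFun, Set.disjoint_left]
  rintro ω ⟨-, h⟩ ⟨-, h'⟩
  exact hs (h.symm.trans h')

theorem setIntegral_comp_eq_sum {Ω S : Type*} {mΩ : MeasurableSpace Ω} {Pr : Measure Ω}
    [IsFiniteMeasure Pr] [Fintype S] {g : Ω → S} (hg : ∀ s, MeasurableSet {ω | g ω = s}) {G : Set Ω}
    (hG : MeasurableSet G) (φ : S → ℝ) :
    ∫ ω in G, φ (g ω) ∂Pr = ∑ s, Pr.real (G ∩ {ω | g ω = s}) * φ s := by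
  have hm : Measurable fun ω => φ (g ω) := by
    let : MeasurableSpace S := ⊤
    have : Measurable g := measurable_to_countable' hg
    exact (measurable_from_top : Measurable φ).comp this
  have hi : Integrable (fun ω => φ (g ω)) Pr := by
    refine Integrable.of_bound hm.aestronglyMeasurable (∑ s, ‖φ s‖) (ae_of_all _ fun ω => ?_)
    exact single_le_sum (f := fun s => ‖φ s‖) (fun _ _ => norm_nonneg _) (mem_univ (g ω))
  rw [setIntegral_eq_sum_fibers hg hG hi.integrableOn]
  refine sum_congr rfl fun s _ => ?_
  rw [setIntegral_congr_fun (g := fun _ => φ s) (hG.inter (hg s)) fun ω hω => congrArg φ hω.2,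
    setIntegral_const, smul_eq_mul]

variable {A I κ : Type*} {Θ : A → Type*} [∀ a, Fintype (Θ a)] [∀ a, DecidableEq (Θ a)]
  {X : Model A I κ Θ} {τ₀ ζ : ℕ} {Ω : Type*} {mΩ : MeasurableSpace Ω} {Pr : Measure Ω}
  {ℱ : Filtration ℕ mΩ} {θ : ℕ → Ω → (a : A) → Θ a} {r : ℕ → Ω → A → ℝ}
  {α : ℕ → Ω → Finset (A × I)}

namespace IsEpochProcess

theorem measurableSet_type_mem (h : IsEpochProcess X τ₀ ζ Pr ℱ θ r α) (t : ℕ) (a : A)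
    (D : Finset (Θ a)) : MeasurableSet[ℱ t] {ω | θ t ω a ∈ D} := by
  have : {ω | θ t ω a ∈ D} = ⋃ s ∈ D, {ω | θ t ω a = s} := by
    ext ω
    simp
  rw [this]
  exact MeasurableSet.biUnion D.countable_toSet fun s _ => h.types_adapted t a s

theorem measurable_epochReward (h : IsEpochProcess X τ₀ ζ Pr ℱ θ r α) (k : ℕ) (a : A) :
    Measurable[ℱ (epochStart τ₀ ζ (k + 1))] (epochReward τ₀ ζ r k a) := by
  refine Measurable.const_mul ?_ _
  refine Finset.measurable_fun_sum _ fun t ht => ?_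
  exact (h.rewards_adapted t a).mono (ℱ.mono (mem_Ico.1 ht).2) le_rfl

variable [Finite A] [Finite I]

theorem measurableSet_mem_policy (h : IsEpochProcess X τ₀ ζ Pr ℱ θ r α) {k : ℕ} (hk : 1 ≤ k)
    (e : A × I) : MeasurableSet[ℱ (epochStart τ₀ ζ k)] {ω | e ∈ α k ω} := by
  have : {ω | e ∈ α k ω} = ⋃ M ∈ {M : Finset (A × I) | e ∈ M}, {ω | α k ω = M} := by
    ext ω
    simp
  rw [this]
  exact MeasurableSet.biUnion (Set.to_countable _) fun M _ => h.policy_adapted k hk M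

theorem measurableSet_rewards_types (h : IsEpochProcess X τ₀ ζ Pr ℱ θ r α) {k : ℕ} (hk : 1 ≤ k)
    (t : ℕ) {B : A → Set ℝ} (hB : ∀ a, MeasurableSet (B a)) (D : (a : A) → Finset (Θ a)) :
    MeasurableSet {ω | ∀ e ∈ α k ω, r t ω e.1 ∈ B e.1 ∧ θ (t + 1) ω e.1 ∈ D e.1} := by
  have : {ω | ∀ e ∈ α k ω, r t ω e.1 ∈ B e.1 ∧ θ (t + 1) ω e.1 ∈ D e.1} =
      ⋃ M : Finset (A × I), {ω | α k ω = M} ∩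
        ⋂ e ∈ M, ({ω | r t ω e.1 ∈ B e.1} ∩ {ω | θ (t + 1) ω e.1 ∈ D e.1}) := by
    ext ω
    simp
  rw [this]
  refine MeasurableSet.iUnion fun M => ((ℱ.le _ _ (h.policy_adapted k hk M)).inter ?_)
  refine MeasurableSet.biInter M.countable_toSet fun e _ => MeasurableSet.inter ?_ ?_
  · exact (h.rewards_adapted t e.1).mono (ℱ.le _) le_rfl (hB e.1)
  · exact ℱ.le _ _ (h.measurableSet_type_mem (t + 1) e.1 (D e.1))

variable [IsProbabilityMeasure Pr]

/-- The joint law of the reward and of the next type of one edge, on an event `G` known at time `t`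
on which the edge is played: the factors of the other edges in the product are `1`. -/
theorem measureReal_reward_type (h : IsEpochProcess X τ₀ ζ Pr ℱ θ r α) {k : ℕ} (hk : 1 ≤ k)
    (hα : ∀ ω, ∀ e ∈ α k ω, ∀ e' ∈ α k ω, e.1 = e'.1 → e = e') {t : ℕ}
    (ht : epochStart τ₀ ζ k ≤ t) (ht' : t < epochStart τ₀ ζ (k + 1)) (e : A × I) {G : Set Ω}
    (hG : MeasurableSet[ℱ t] G) (hGe : ∀ ω ∈ G, e ∈ α k ω) {B : Set ℝ} (hB : MeasurableSet B)
    (D : Finset (Θ e.1)) :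
    Pr.real (G ∩ {ω | r t ω e.1 ∈ B ∧ θ (t + 1) ω e.1 ∈ D}) =
      ∫ ω in G, (X.rewardLaw e (θ t ω e.1)).real B * ∑ s' ∈ D, X.P e (θ t ω e.1) s' ∂Pr := by
  classical
  set B' : A → Set ℝ := Function.update (fun _ => Set.univ) e.1 B with hB'
  set D' : (a : A) → Finset (Θ a) := Function.update (fun _ => univ) e.1 D with hD'
  have hB'm : ∀ a, MeasurableSet (B' a) := by
    intro a
    rcases eq_or_ne a e.1 with rfl | ha
    · simpa [hB'] using hB
    · simp [hB', Function.update_of_ne ha]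
  set W := {ω | ∀ e ∈ α k ω, r t ω e.1 ∈ B' e.1 ∧ θ (t + 1) ω e.1 ∈ D' e.1} with hW
  have hWm : MeasurableSet W := h.measurableSet_rewards_types hk t hB'm D'
  have hGm := ℱ.le t _ hG
  have hGW : G ∩ {ω | r t ω e.1 ∈ B ∧ θ (t + 1) ω e.1 ∈ D} = G ∩ W := by
    ext ω
    refine and_congr_right fun hω => ⟨fun hr e' he' => ?_, fun hr => ?_⟩
    · by_cases hee : e'.1 = e.1
      · obtain rfl := hα ω e' he' e (hGe ω hω) hee
        simpa [hB', hD'] using hr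
      · simp [hB', hD', Function.update_of_ne hee]
    · simpa [hB', hD'] using hr e (hGe ω hω)
  have hcond := h.transition k hk t ht ht' B' hB'm D'
  have hint : Integrable (W.indicator fun _ => (1 : ℝ)) Pr :=
    (integrable_const 1).indicator hWm
  rw [hGW, ← setIntegral_congr_ae (f := Pr[W.indicator (fun _ => (1 : ℝ)) | ℱ t]) hGm,
    setIntegral_condExp (ℱ.le t) hint hG, setIntegral_indicator hWm, setIntegral_const]
  · simp
  filter_upwards [hcond] with ω hω hωG
  rw [hω, prod_eq_single_of_mem e (hGe ω hωG)]
  · simp [hB', hD']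
  · intro e' he' hne
    have hee : e'.1 ≠ e.1 := fun hee => hne (hα ω e' he' e (hGe ω hωG) hee)
    have := X.rewardLaw_prob e' (θ t ω e'.1)
    simp [hB', hD', Function.update_of_ne hee, Matrix.sum_row_of_mem_rowStochastic (X.stochastic e')]

/-- Within an epoch, the type of a matched agent moves according to the powers of the transition
matrix of its edge. -/
theorem measureReal_type_eq (h : IsEpochProcess X τ₀ ζ Pr ℱ θ r α) {k : ℕ} (hk : 1 ≤ k)
    (hα : ∀ ω, ∀ e ∈ α k ω, ∀ e' ∈ α k ω, e.1 = e'.1 → e = e') (e : A × I) {G : Set Ω}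
    (hG : MeasurableSet[ℱ (epochStart τ₀ ζ k)] G) (hGe : ∀ ω ∈ G, e ∈ α k ω) {u : ℕ}
    (hu : u ≤ epochLength τ₀ ζ k) (s' : Θ e.1) :
    Pr.real (G ∩ {ω | θ (epochStart τ₀ ζ k + u) ω e.1 = s'}) =
      ∑ s, Pr.real (G ∩ {ω | θ (epochStart τ₀ ζ k) ω e.1 = s}) * (X.P e ^ u) s s' := by
  induction u generalizing s' with
  | zero => simp [Matrix.one_apply]
  | succ u ih =>
    set t := epochStart τ₀ ζ k + u with ht
    have ht' : t < epochStart τ₀ ζ (k + 1) := by rw [epochStart_succ τ₀ ζ hk]; omega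
    have hGt : MeasurableSet[ℱ t] G := ℱ.mono (by omega) _ hG
    have hstep := h.measureReal_reward_type hk hα (by omega) ht' e hGt hGe MeasurableSet.univ {s'}
    have hone : ∀ s, (X.rewardLaw e s).real Set.univ = 1 := fun s => by
      have := X.rewardLaw_prob e s
      simp
    simp only [Set.mem_univ, true_and, mem_singleton, hone, one_mul, sum_singleton] at hstep
    have hsum := setIntegral_comp_eq_sum (Pr := Pr) (fun s => ℱ.le _ _ (h.types_adapted t e.1 s))
      (ℱ.le _ _ hGt) (fun s => X.P e s s')
    rw [← add_assoc, ← ht, hstep, hsum]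
    simp_rw [ih (by omega), sum_mul, pow_succ, Matrix.mul_apply, mul_sum]
    rw [sum_comm]
    simp_rw [mul_assoc]

theorem ae_reward_mem_Icc (h : IsEpochProcess X τ₀ ζ Pr ℱ θ r α) {k : ℕ} (hk : 1 ≤ k)
    (hα : ∀ ω, ∀ e ∈ α k ω, ∀ e' ∈ α k ω, e.1 = e'.1 → e = e') (e : A × I) {t : ℕ}
    (ht : epochStart τ₀ ζ k ≤ t) (ht' : t < epochStart τ₀ ζ (k + 1)) :
    ∀ᵐ ω ∂Pr, e ∈ α k ω → r t ω e.1 ∈ Set.Icc (0 : ℝ) 1 := by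
  have hstep := h.measureReal_reward_type hk hα ht ht' e
    (ℱ.mono ht _ (h.measurableSet_mem_policy hk e)) (fun ω hω => hω)
    (measurableSet_Icc (a := (0 : ℝ)) (b := 1)).compl univ
  have hzero : ∀ s, (X.rewardLaw e s).real (Set.Icc 0 1)ᶜ = 0 := fun s => by
    simp [Measure.real, X.rewardLaw_support e s]
  simp only [hzero, zero_mul, integral_zero, mem_univ, and_true] at hstep
  filter_upwards [measure_eq_zero_iff_ae_notMem.1 ((measureReal_eq_zero_iff).1 hstep)] with ω hω he
  by_contra hr
  exact hω ⟨he, hr⟩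

theorem integrableOn_reward (h : IsEpochProcess X τ₀ ζ Pr ℱ θ r α) {k : ℕ} (hk : 1 ≤ k)
    (hα : ∀ ω, ∀ e ∈ α k ω, ∀ e' ∈ α k ω, e.1 = e'.1 → e = e') (e : A × I) {t : ℕ}
    (ht : epochStart τ₀ ζ k ≤ t) (ht' : t < epochStart τ₀ ζ (k + 1)) :
    IntegrableOn (fun ω => r t ω e.1) {ω | e ∈ α k ω} Pr :=
  Integrable.of_mem_Icc 0 1 ((h.rewards_adapted t e.1).mono (ℱ.le _) le_rfl).aemeasurable
    ((ae_restrict_iff' (ℱ.le _ _ (h.measurableSet_mem_policy hk e))).2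
      (h.ae_reward_mem_Icc hk hα e ht ht'))

theorem setIntegral_reward (h : IsEpochProcess X τ₀ ζ Pr ℱ θ r α) {k : ℕ} (hk : 1 ≤ k)
    (hα : ∀ ω, ∀ e ∈ α k ω, ∀ e' ∈ α k ω, e.1 = e'.1 → e = e') (e : A × I) {t : ℕ}
    (ht : epochStart τ₀ ζ k ≤ t) (ht' : t < epochStart τ₀ ζ (k + 1)) {G : Set Ω}
    (hG : MeasurableSet[ℱ t] G) (hGe : ∀ ω ∈ G, e ∈ α k ω) :
    ∫ ω in G, r t ω e.1 ∂Pr =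
      ∑ s, Pr.real (G ∩ {ω | θ t ω e.1 = s}) * X.meanReward e s := by
  have hrm : Measurable fun ω => r t ω e.1 := (h.rewards_adapted t e.1).mono (ℱ.le _) le_rfl
  rw [setIntegral_eq_sum_fibers (fun s => ℱ.le _ _ (h.types_adapted t e.1 s)) (ℱ.le _ _ hG)
    ((h.integrableOn_reward hk hα e ht ht').mono_set hGe)]
  refine sum_congr rfl fun s _ => ?_
  set H := G ∩ {ω | θ t ω e.1 = s} with hH
  have hHm : MeasurableSet[ℱ t] H := hG.inter (h.types_adapted t e.1 s)
  have := X.rewardLaw_prob e s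
  have hmap : (Pr.restrict H).map (fun ω => r t ω e.1) = Pr H • X.rewardLaw e s := by
    ext B hB
    have hstep := h.measureReal_reward_type hk hα ht ht' e hHm (fun ω hω => hGe ω hω.1) hB univ
    have hP : ∀ s, ∑ s' : Θ e.1, X.P e s s' = 1 :=
      Matrix.sum_row_of_mem_rowStochastic (X.stochastic e)
    simp only [mem_univ, and_true, hP, mul_one] at hstep
    rw [setIntegral_congr_fun (g := fun _ => (X.rewardLaw e s).real B) (ℱ.le _ _ hHm)
      (fun ω hω => by simp only [show θ t ω e.1 = s from hω.2]), setIntegral_const,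
      smul_eq_mul] at hstep
    rw [Measure.map_apply hrm hB, Measure.restrict_apply (hrm hB), Measure.smul_apply, smul_eq_mul,
      Set.inter_comm]
    refine (ENNReal.toReal_eq_toReal_iff' (measure_ne_top _ _)
      (ENNReal.mul_ne_top (measure_ne_top _ _) (measure_ne_top _ _))).1 ?_
    rw [ENNReal.toReal_mul]
    exact hstep
  have := integral_map (μ := Pr.restrict H) hrm.aemeasurable (f := fun x : ℝ => x)
    measurable_id.aestronglyMeasurable
  rw [← this, hmap, integral_smul_measure, smul_eq_mul]
  rfl

/-- On any event `G` known at the beginning of epoch `k` on which `e` is played, the mean epoch reward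
of `e` is close to its stationary reward. -/
theorem abs_setIntegral_epochReward_sub_le (h : IsEpochProcess X τ₀ ζ Pr ℱ θ r α) (hτ₀ : 0 < τ₀)
    {k : ℕ} (hk : 1 ≤ k) (hα : ∀ ω, ∀ e ∈ α k ω, ∀ e' ∈ α k ω, e.1 = e'.1 → e = e') (e : A × I)
    {μ C : ℝ} (hC : IsMixingConstant (X.P e) (X.meanReward e) μ C) {G : Set Ω}
    (hG : MeasurableSet[ℱ (epochStart τ₀ ζ k)] G) (hGe : ∀ ω ∈ G, e ∈ α k ω) :
    |∫ ω in G, epochReward τ₀ ζ r k e.1 ω ∂Pr - μ * Pr.real G| ≤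
      C / (2 * epochLength τ₀ ζ k) * Pr.real G := by
  set τ := epochLength τ₀ ζ k with hτ
  set p : Θ e.1 → ℝ := fun s => Pr.real (G ∩ {ω | θ (epochStart τ₀ ζ k) ω e.1 = s}) with hp
  have hτ1 : 1 ≤ τ := by simp only [hτ, epochLength]; omega
  have hsum : Pr.real G = ∑ s, p s := by
    have := setIntegral_comp_eq_sum (Pr := Pr)
      (fun s => ℱ.le _ _ (h.types_adapted (epochStart τ₀ ζ k) e.1 s)) (ℱ.le _ _ hG) (fun _ => 1)
    simpa using this
  have hlt : ∀ u ∈ range τ, epochStart τ₀ ζ k + u < epochStart τ₀ ζ (k + 1) := by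
    intro u hu
    rw [epochStart_succ τ₀ ζ hk, ← hτ]
    have := mem_range.1 hu
    omega
  have hint : ∫ ω in G, epochReward τ₀ ζ r k e.1 ω ∂Pr =
      ∑ s, p s * (1 / (τ : ℝ) * ∑ u ∈ range τ, ∑ s', (X.P e ^ u) s s' * X.meanReward e s') := by
    have hlen : epochStart τ₀ ζ (k + 1) - epochStart τ₀ ζ k = τ := by
      rw [epochStart_succ τ₀ ζ hk]; omega
    simp only [epochReward]
    rw [integral_const_mul, ← hτ]
    simp_rw [sum_Ico_eq_sum_range, hlen]
    rw [integral_finsetSum _ fun u hu =>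
      (h.integrableOn_reward hk hα e (by omega) (hlt u hu)).mono_set hGe]
    have hu : ∀ u ∈ range τ, ∫ ω in G, r (epochStart τ₀ ζ k + u) ω e.1 ∂Pr =
        ∑ s, p s * ∑ s', (X.P e ^ u) s s' * X.meanReward e s' := by
      intro u hu
      rw [h.setIntegral_reward hk hα e (by omega) (hlt u hu) (ℱ.mono (by omega) _ hG) hGe]
      simp_rw [h.measureReal_type_eq hk hα e hG hGe (mem_range.1 hu).le, sum_mul, mul_sum]
      rw [sum_comm]
      simp_rw [mul_assoc, hp]
    rw [sum_congr rfl hu, sum_comm, mul_sum]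
    refine sum_congr rfl fun s _ => ?_
    rw [← mul_sum]
    ring
  rw [hint, hsum, mul_sum, mul_sum, ← sum_sub_distrib]
  refine (abs_sum_le_sum_abs _ _).trans (sum_le_sum fun s _ => ?_)
  have hp0 : 0 ≤ p s := measureReal_nonneg
  rw [mul_comm μ, ← mul_sub, abs_mul, abs_of_nonneg hp0, abs_sub_comm, mul_comm]
  exact mul_le_mul_of_nonneg_right (hC.2 τ hτ1 s) hp0

theorem ae_epochReward_mem_Icc (h : IsEpochProcess X τ₀ ζ Pr ℱ θ r α) (hτ₀ : 0 < τ₀)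
    {k : ℕ} (hk : 1 ≤ k) (hα : ∀ ω, ∀ e ∈ α k ω, ∀ e' ∈ α k ω, e.1 = e'.1 → e = e') (e : A × I) :
    ∀ᵐ ω ∂Pr, e ∈ α k ω → epochReward τ₀ ζ r k e.1 ω ∈ Set.Icc (0 : ℝ) 1 := by
  have hall : ∀ᵐ ω ∂Pr, ∀ t ∈ Ico (epochStart τ₀ ζ k) (epochStart τ₀ ζ (k + 1)),
      e ∈ α k ω → r t ω e.1 ∈ Set.Icc (0 : ℝ) 1 :=
    (Finset.eventually_all _).2 fun t ht =>
      h.ae_reward_mem_Icc hk hα e (mem_Ico.1 ht).1 (mem_Ico.1 ht).2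
  filter_upwards [hall] with ω hω he
  have hτ : (0 : ℝ) < epochLength τ₀ ζ k := by
    simp only [epochLength]
    exact_mod_cast (by omega : 0 < τ₀ + ζ * k)
  refine ⟨mul_nonneg (by positivity) (sum_nonneg fun t ht => (hω t ht he).1), ?_⟩
  have := sum_le_card_nsmul _ _ 1 fun t ht => (hω t ht he).2
  rw [Nat.card_Ico, epochStart_succ τ₀ ζ hk, add_tsub_cancel_left, nsmul_one] at this
  rw [epochReward, one_div, inv_mul_le_iff₀ hτ, mul_one, epochStart_succ τ₀ ζ hk]
  exact this

end IsEpochProcess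

end EpochDynamics

/-! ### Confidence windows -/

section Windows

/-- The biases of distinct epoch rewards add up to at most the mixing part of the confidence window:
the sum is largest for the earliest epochs, where it is dominated by an integral. -/
theorem sum_bias_le_mixingError {τ₀ ζ : ℕ} (hτ₀ : 0 < τ₀) (hζ : 0 < ζ) {C : ℝ} (hC : 0 < C)
    (s : Finset ℕ) (hs : ∀ k ∈ s, 1 ≤ k) :
    ∑ k ∈ s, C / (2 * epochLength τ₀ ζ k) ≤ mixingError τ₀ ζ C s.card := by
  have hτ : (0 : ℝ) < τ₀ := by exact_mod_cast hτ₀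
  have hz : (0 : ℝ) < ζ := by exact_mod_cast hζ
  have key : ∑ k ∈ s, ζ / (epochLength τ₀ ζ k : ℝ) ≤ Real.log (1 + s.card * ζ / τ₀) := by
    induction s using Finset.induction_on_max with
    | empty => simp
    | insert a s ha ih =>
      have has : a ∉ s := fun h => lt_irrefl _ (ha a h)
      have hcard : s.card + 1 ≤ a := by
        have hsub : s ⊆ Ico 1 a := fun k hk => mem_Ico.2 ⟨hs k (mem_insert_of_mem hk), ha k hk⟩
        have := card_le_card hsub
        have := hs a (mem_insert_self _ _)
        rw [Nat.card_Ico] at *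
        omega
      rw [sum_insert has, card_insert_of_notMem has]
      have ih := ih fun k hk => hs k (mem_insert_of_mem hk)
      set c : ℝ := (s.card : ℝ) with hc
      have hc0 : 0 ≤ c := Nat.cast_nonneg _
      have hca : c + 1 ≤ a := by rw [hc]; exact_mod_cast hcard
      have h1 : ζ / (epochLength τ₀ ζ a : ℝ) ≤ ζ / (τ₀ + (c + 1) * ζ) := by
        refine div_le_div_of_nonneg_left hz.le (by positivity) ?_
        simp only [epochLength]
        push_cast
        nlinarith
      have h2 : ζ / (τ₀ + (c + 1) * ζ) ≤
          Real.log (1 + (c + 1) * ζ / τ₀) - Real.log (1 + c * ζ / τ₀) := by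
        rw [← Real.log_div (by positivity) (by positivity)]
        have hpos : 0 < (1 + (c + 1) * ζ / τ₀) / (1 + c * ζ / τ₀) := by positivity
        refine le_trans (le_of_eq ?_) (Real.one_sub_inv_le_log_of_pos hpos)
        field_simp
        ring
      push_cast
      rw [← hc]
      linarith
  have heq : ∑ k ∈ s, C / (2 * epochLength τ₀ ζ k) =
      C / (2 * ζ) * ∑ k ∈ s, ζ / (epochLength τ₀ ζ k : ℝ) := by
    rw [mul_sum]
    refine sum_congr rfl fun k _ => ?_
    field_simp
  rw [heq, mixingError]
  calc C / (2 * ζ) * ∑ k ∈ s, ζ / (epochLength τ₀ ζ k : ℝ)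
      ≤ C / (2 * ζ) * Real.log (1 + s.card * ζ / τ₀) :=
        mul_le_mul_of_nonneg_left key (by positivity)
    _ = C / 2 * (1 / (ζ : ℝ) * Real.log (1 + s.card * ζ / τ₀)) := by field_simp
    _ ≤ _ := by
        refine mul_le_mul_of_nonneg_left ?_ (by positivity)
        have : 0 ≤ 1 / ((ζ : ℝ) + τ₀) := by positivity
        linarith

theorem log_one_add_sq_le {s : ℝ} (hs : 0 ≤ s) : Real.log (1 + s ^ 2) ≤ s := by
  rw [Real.log_le_iff_le_exp (by positivity)]
  have := Real.sum_le_exp_of_nonneg hs 4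
  simp only [sum_range_succ, sum_range_zero, Nat.factorial] at this
  norm_num at this
  nlinarith [mul_nonneg hs (sq_nonneg (s - 3 / 2))]

theorem mixingError_le_rho {τ₀ ζ : ℕ} (hτ₀ : 0 < τ₀) (hζ : 0 < ζ) {C : ℝ} (hC : 0 < C) {k : ℕ}
    (hk : 1 ≤ k) : mixingError τ₀ ζ C k ≤ rho τ₀ ζ C / Real.sqrt τ₀ * Real.sqrt k := by
  have hτ : (0 : ℝ) < τ₀ := by exact_mod_cast hτ₀
  have hz : (0 : ℝ) < ζ := by exact_mod_cast hζ
  have hk1 : (1 : ℝ) ≤ k := by exact_mod_cast hk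
  set s := Real.sqrt (k * ζ / τ₀) with hs
  have hs0 : 0 ≤ s := Real.sqrt_nonneg _
  have hs2 : s ^ 2 = k * ζ / τ₀ := Real.sq_sqrt (by positivity)
  set z : ℝ := ζ / (ζ + τ₀) with hzdef
  have hz0 : 0 ≤ z := by positivity
  have hz1 : z * (1 + s ^ 2) ≤ s ^ 2 := by
    rw [hs2, hzdef, div_mul_eq_mul_div, div_le_iff₀ (by positivity)]
    have hzk : (ζ : ℝ) ≤ k * ζ := by nlinarith
    have : (ζ : ℝ) = τ₀ * (ζ / τ₀) := by field_simp
    have h1 : (k : ℝ) * ζ / τ₀ * (ζ + τ₀) = k * ζ / τ₀ * ζ + k * ζ := by field_simp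
    rw [h1]
    nlinarith
  have key : z + Real.log (1 + s ^ 2) ≤ (z + 1) * s := by
    rcases le_or_gt 1 s with h1 | h1
    · have := log_one_add_sq_le hs0
      nlinarith
    · have hlog : Real.log (1 + s ^ 2) ≤ s ^ 2 := by
        have := Real.log_le_sub_one_of_pos (by positivity : 0 < 1 + s ^ 2)
        linarith
      -- `z ≤ s² / (1 + s²)` and `s ≤ 1 + s²` give `z (1 - s) ≤ s (1 - s)`
      have hzs : z ≤ s := by nlinarith [sq_nonneg (s - 1)]
      nlinarith
  have hsq : rho τ₀ ζ C / Real.sqrt τ₀ * Real.sqrt k = C / (2 * ζ) * ((z + 1) * s) := by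
    rw [hs, Real.sqrt_div (by positivity), Real.sqrt_mul (by positivity), rho, ← hzdef]
    have h1 : Real.sqrt ζ ≠ 0 := (Real.sqrt_pos.2 hz).ne'
    have h2 : Real.sqrt τ₀ ≠ 0 := (Real.sqrt_pos.2 hτ).ne'
    have h3 : (ζ : ℝ) = Real.sqrt ζ * Real.sqrt ζ := (Real.mul_self_sqrt hz.le).symm
    have h4 : C / (2 * (ζ : ℝ)) = C / (2 * (Real.sqrt ζ * Real.sqrt ζ)) := by rw [← h3]
    rw [h4]
    field_simp
  rw [hsq, mixingError, ← hs2]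
  calc C / 2 * (1 / ((ζ : ℝ) + τ₀) + 1 / ζ * Real.log (1 + s ^ 2))
      = C / (2 * ζ) * (z + Real.log (1 + s ^ 2)) := by rw [hzdef]; field_simp
    _ ≤ _ := mul_le_mul_of_nonneg_left key (by positivity)

theorem rho_nonneg {τ₀ ζ : ℕ} {C : ℝ} (hC : 0 < C) : 0 ≤ rho τ₀ ζ C := by
  unfold rho
  positivity

theorem pullBound_nonneg (τ₀ m n : ℕ) (Δ ρ : ℝ) : 0 ≤ pullBound τ₀ m n Δ ρ := by
  unfold pullBound
  positivity

/-- After `pullBound` plays, twice the confidence window is at most the gap. -/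
theorem two_mul_confidence_le {τ₀ ζ m n k t : ℕ} (hτ₀ : 0 < τ₀) (hζ : 0 < ζ) {C Δ : ℝ} (hC : 0 < C)
    (hΔ : 0 < Δ) (hk : 1 ≤ k) (ht : 1 ≤ t) (htn : t ≤ n)
    (hpull : pullBound τ₀ m n Δ (rho τ₀ ζ C) ≤ k) : 2 * confidence τ₀ ζ m C k t ≤ Δ := by
  have hk0 : (0 : ℝ) < k := by exact_mod_cast hk
  have hsk : 0 < Real.sqrt k := Real.sqrt_pos.2 hk0
  set D := rho τ₀ ζ C / Real.sqrt τ₀ + Real.sqrt (6 * Real.log n + 4 * Real.log m) with hD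
  have hD0 : 0 ≤ D := add_nonneg (div_nonneg (rho_nonneg hC) (Real.sqrt_nonneg _))
    (Real.sqrt_nonneg _)
  have hconf : confidence τ₀ ζ m C k t ≤ D / Real.sqrt k := by
    rw [confidence, hD, add_div]
    refine add_le_add ?_ ?_
    · rw [div_le_div_iff₀ hk0 hsk]
      calc mixingError τ₀ ζ C k * Real.sqrt k
          ≤ rho τ₀ ζ C / Real.sqrt τ₀ * Real.sqrt k * Real.sqrt k :=
            mul_le_mul_of_nonneg_right (mixingError_le_rho hτ₀ hζ hC hk) hsk.le
        _ = rho τ₀ ζ C / Real.sqrt τ₀ * k := by rw [mul_assoc, Real.mul_self_sqrt hk0.le]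
    · rw [← Real.sqrt_div' _ hk0.le]
      refine Real.sqrt_le_sqrt ?_
      have hlog : Real.log t ≤ Real.log n :=
        Real.log_le_log (by exact_mod_cast ht) (by exact_mod_cast htn)
      rw [add_div, div_mul_eq_mul_div, div_mul_eq_mul_div]
      gcongr
  have hDk : 2 * D / Δ ≤ Real.sqrt k := by
    refine Real.le_sqrt_of_sq_le (le_trans (le_of_eq ?_) hpull)
    rw [pullBound, ← hD]
    ring
  rw [div_le_iff₀ hΔ] at hDk
  have : 2 * (D / Real.sqrt k) ≤ Δ := by
    rw [← mul_div_assoc, div_le_iff₀ hsk]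
    linarith
  linarith

end Windows

/-! ### Deviations of biased observations -/

section Deviations

variable {Ω : Type*} {mΩ : MeasurableSpace Ω} {Pr : Measure Ω} [IsProbabilityMeasure Pr]
  {𝒢 : Filtration ℕ mΩ} {E : ℕ → Set Ω} {V : ℕ → Ω → ℝ}

/-- Hoeffding's inequality for biased observations: `V k` has conditional mean at most `ν + δ k` on
`E k`, and `b j` bounds the total bias of any `j` observations. -/
theorem measureReal_biased_excess_ge_le (hE : ∀ k, 1 ≤ k → MeasurableSet[𝒢 k] (E k))
    (hV : ∀ k, 1 ≤ k → Measurable[𝒢 (k + 1)] (V k))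
    (hV01 : ∀ k, 1 ≤ k → ∀ᵐ ω ∂Pr, ω ∈ E k → V k ω ∈ Set.Icc (0 : ℝ) 1)
    {ν : ℝ} {δ : ℕ → ℝ} (hδ : ∀ k, 0 ≤ ν + δ k)
    (hmean : ∀ k, 1 ≤ k → ∀ G, MeasurableSet[𝒢 k] G → G ⊆ E k →
      ∫ ω in G, V k ω ∂Pr ≤ (ν + δ k) * Pr.real G)
    {b : ℕ → ℝ} (hb : ∀ s : Finset ℕ, (∀ k ∈ s, 1 ≤ k) → ∑ k ∈ s, δ k ≤ b s.card)
    {ε : ℕ → ℝ} (hε : ∀ j, 0 ≤ ε j) (n : ℕ) :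
    Pr.real {ω | 1 ≤ occurrences E n ω ∧ b (occurrences E n ω) +
        occurrences E n ω * ε (occurrences E n ω) ≤ excess E V (fun _ => ν) n ω} ≤
      ∑ j ∈ Icc 1 n, Real.exp (-(2 * j * ε j ^ 2)) := by
  classical
  -- truncated observations, which are almost surely the same
  set Y : ℕ → Ω → ℝ := fun k ω => max 0 (min 1 (V k ω)) with hYdef
  set q : ℕ → ℝ := fun k => min 1 (ν + δ k) with hqdef
  have hY : ∀ k, 1 ≤ k → Measurable[𝒢 (k + 1)] (Y k) := fun k hk =>
    Measurable.max (@measurable_const _ _ _ (𝒢 (k + 1)) _)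
      (Measurable.min (@measurable_const _ _ _ (𝒢 (k + 1)) _) (hV k hk))
  have hY01 : ∀ k ω, Y k ω ∈ Set.Icc (0 : ℝ) 1 := fun k ω =>
    ⟨le_max_left _ _, max_le zero_le_one (min_le_left _ _)⟩
  have hYV : ∀ k ω, V k ω ∈ Set.Icc (0 : ℝ) 1 → Y k ω = V k ω := fun k ω h => by
    simp only [hYdef]
    rw [min_eq_right h.2, max_eq_right h.1]
  have hq : ∀ k, q k ∈ Set.Icc (0 : ℝ) 1 := fun k =>
    ⟨le_min zero_le_one (hδ k), min_le_left _ _⟩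
  have hYmean : ∀ k, 1 ≤ k → ∀ G, MeasurableSet[𝒢 k] G → G ⊆ E k →
      ∫ ω in G, Y k ω ∂Pr ≤ q k * Pr.real G := by
    intro k hk G hG hGE
    have hGm := 𝒢.le _ _ hG
    rw [hqdef]
    simp only
    rw [min_mul_of_nonneg _ _ measureReal_nonneg, one_mul]
    refine le_min ?_ ?_
    · have hYi : Integrable (Y k) Pr := Integrable.of_mem_Icc 0 1
        ((hY k hk).mono (𝒢.le _) le_rfl).aemeasurable (ae_of_all _ (hY01 k))
      have := setIntegral_mono_on hYi.integrableOn (integrable_const (1 : ℝ)).integrableOn hGm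
        fun ω _ => (hY01 k ω).2
      simpa using this
    · refine le_trans (le_of_eq ?_) (hmean k hk G hG hGE)
      refine setIntegral_congr_ae hGm ?_
      filter_upwards [hV01 k hk] with ω hω hωG
      exact hYV k ω (hω (hGE hωG))
  have hall : ∀ᵐ ω ∂Pr, ∀ k ∈ Icc 1 n, ω ∈ E k → V k ω ∈ Set.Icc (0 : ℝ) 1 :=
    (Finset.eventually_all _).2 fun k hk => hV01 k (mem_Icc.1 hk).1
  have hsub : ({ω | 1 ≤ occurrences E n ω ∧ b (occurrences E n ω) +
        occurrences E n ω * ε (occurrences E n ω) ≤ excess E V (fun _ => ν) n ω} : Set Ω) ≤ᵐ[Pr]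
      (⋃ j ∈ Icc 1 n, {ω | occurrences E n ω = j ∧ j * ε j ≤ excess E Y q n ω} : Set Ω) := by
    filter_upwards [hall] with ω hω hmem
    obtain ⟨h1, h2⟩ := hmem
    refine Set.mem_biUnion (mem_Icc.2 ⟨h1, occurrences_le n ω⟩ : occurrences E n ω ∈ Icc 1 n)
      ⟨rfl, ?_⟩
    have hbias := hb ((Icc 1 n).filter fun k => ω ∈ E k) fun k hk =>
      (mem_Icc.1 (mem_filter.1 hk).1).1
    have hcmp : excess E V (fun _ => ν) n ω - ∑ k ∈ (Icc 1 n).filter (fun k => ω ∈ E k), δ k ≤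
        excess E Y q n ω := by
      unfold excess
      rw [← sum_sub_distrib]
      refine sum_le_sum fun k hk => ?_
      obtain ⟨hk, hkE⟩ := mem_filter.1 hk
      rw [hYV k ω (hω k hk hkE)]
      have : q k ≤ ν + δ k := min_le_right _ _
      linarith
    change _ ≤ b (occurrences E n ω) at hbias
    linarith
  calc _ ≤ Pr.real (⋃ j ∈ Icc 1 n, {ω | occurrences E n ω = j ∧ j * ε j ≤ excess E Y q n ω}) :=
        ENNReal.toReal_mono (measure_ne_top _ _) (measure_mono_ae hsub)
    _ ≤ ∑ j ∈ Icc 1 n, Pr.real {ω | occurrences E n ω = j ∧ j * ε j ≤ excess E Y q n ω} :=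
        measureReal_biUnion_finset_le _ _
    _ ≤ _ := sum_le_sum fun j _ => measureReal_excess_ge_le hE hY hY01 hq hYmean (hε j) n j

end Deviations

/-! ### Counting plays -/

section PullCounts

variable {A I : Type*} [DecidableEq A] [DecidableEq I] {Ω : Type*} {α : ℕ → Ω → Finset (A × I)}

theorem pullCount_succ (e : A × I) (n : ℕ) (ω : Ω) : pullCount α e (n + 1) ω =
    pullCount α e n ω + if e ∈ α (n + 1) ω then 1 else 0 := by
  unfold pullCount
  rw [← insert_Icc_right_eq_Icc_add_one (by omega : 1 ≤ n + 1), filter_insert]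
  split_ifs with h
  · rw [card_insert_of_notMem (by simp)]
  · rfl

theorem pullCount_mono (e : A × I) (ω : Ω) : Monotone fun n => pullCount α e n ω :=
  monotone_nat_of_le_succ fun n => by rw [pullCount_succ]; omega

theorem pullCount_eq_occurrences (e : A × I) (n : ℕ) (ω : Ω) :
    pullCount α e n ω = occurrences (fun k => {ω | e ∈ α k ω}) n ω := by
  unfold pullCount occurrences
  congr

/-- Once an edge has been played, it is played at most `x` times while its count is below `x`. -/
theorem card_plays_below_le (e : A × I) (ω : Ω) {p n : ℕ} (hpn : p ≤ n) (hp : 1 ≤ pullCount α e p ω)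
    {x : ℝ} (hx : 0 ≤ x) :
    ((((Ico p n).filter fun l => e ∈ α (l + 1) ω ∧ (pullCount α e l ω : ℝ) < x).card : ℕ) : ℝ) ≤ x
      := by
  suffices H : ((Ico p n).filter fun l => e ∈ α (l + 1) ω ∧ (pullCount α e l ω : ℝ) < x).card + 1 ≤
      pullCount α e n ω ∧ ((((Ico p n).filter
        fun l => e ∈ α (l + 1) ω ∧ (pullCount α e l ω : ℝ) < x).card : ℕ) : ℝ) ≤ x from H.2
  induction n, hpn using Nat.le_induction with
  | base => simpa using ⟨hp, hx⟩
  | succ n hpn ih =>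
    rw [← insert_Ico_right_eq_Ico_add_one hpn, filter_insert, pullCount_succ]
    split_ifs with h h' h'
    · rw [card_insert_of_notMem (by simp)]
      refine ⟨by omega, le_trans ?_ h.2.le⟩
      exact_mod_cast ih.1
    · exact absurd h.1 h'
    · exact ⟨by omega, ih.2⟩
    · exact ⟨by omega, ih.2⟩

theorem pullCount_le_one_add_card (e : A × I) (ω : Ω) {p : ℕ} (hp : pullCount α e p ω = 1) (n : ℕ) :
    pullCount α e n ω ≤ 1 + ((Ico p n).filter fun l => e ∈ α (l + 1) ω).card := by
  rcases le_total n p with hn | hn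
  · have : pullCount α e n ω ≤ pullCount α e p ω := pullCount_mono e ω hn
    omega
  · induction n, hn using Nat.le_induction with
    | base => omega
    | succ n hpn ih =>
      rw [← insert_Ico_right_eq_Ico_add_one hpn, filter_insert, pullCount_succ]
      split_ifs
      · rw [card_insert_of_notMem (by simp)]
        omega
      · omega

end PullCounts

/-! ### Stationary rewards -/

section StationaryRewards

variable {A I κ : Type*} {Θ : A → Type*} [∀ a, Fintype (Θ a)] [∀ a, DecidableEq (Θ a)]
  {X : Model A I κ Θ}

theorem meanReward_mem_Icc (X : Model A I κ Θ) (e : A × I) (s : Θ e.1) :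
    X.meanReward e s ∈ Set.Icc (0 : ℝ) 1 := by
  have := X.rewardLaw_prob e s
  have hae : ∀ᵐ x ∂X.rewardLaw e s, x ∈ Set.Icc (0 : ℝ) 1 := by
    rw [ae_iff]
    exact X.rewardLaw_support e s
  refine ⟨integral_nonneg_of_ae (hae.mono fun x hx => hx.1), ?_⟩
  have hi : Integrable (fun x : ℝ => x) (X.rewardLaw e s) :=
    Integrable.of_mem_Icc 0 1 measurable_id.aemeasurable hae
  have := integral_mono_ae hi (integrable_const 1) (hae.mono fun x hx => hx.2)
  simpa [Model.meanReward] using this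

theorem stationaryReward_mem_Icc {π : (e : A × I) → Θ e.1 → ℝ} {e : A × I}
    (hπ : IsStationaryDist (X.P e) (π e)) : X.stationaryReward π e ∈ Set.Icc (0 : ℝ) 1 := by
  have hsum : ∑ s, π e s = 1 := hπ.1.2
  refine ⟨sum_nonneg fun s _ => mul_nonneg (hπ.1.1 s) (meanReward_mem_Icc X e s).1, ?_⟩
  rw [← hsum]
  exact sum_le_sum fun s _ => mul_le_of_le_one_right (hπ.1.1 s) (meanReward_mem_Icc X e s).2

end StationaryRewards

/-! ### The expected number of plays of a sub-optimal edge -/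

section Regret

theorem exists_pullBound_le_mul_log (τ₀ m : ℕ) (Δ ρ : ℝ) :
    ∃ K, ∀ n : ℕ, 3 ≤ n → pullBound τ₀ m n Δ ρ ≤ K * Real.log n := by
  refine ⟨4 / Δ ^ 2 * (2 * ((ρ / Real.sqrt τ₀) ^ 2 + (6 + 4 * Real.log m))), fun n hn => ?_⟩
  have hlog : 1 ≤ Real.log n := by
    rw [Real.le_log_iff_exp_le (by positivity)]
    have h3 : (3 : ℝ) ≤ n := by exact_mod_cast hn
    linarith [Real.exp_one_lt_d9]
  have hm : 0 ≤ Real.log (m : ℝ) := Real.log_natCast_nonneg _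
  rw [pullBound, mul_assoc]
  refine mul_le_mul_of_nonneg_left ?_ (by positivity)
  set a := ρ / Real.sqrt τ₀
  have hsq := Real.sq_sqrt (by positivity : 0 ≤ 6 * Real.log n + 4 * Real.log m)
  set b := Real.sqrt (6 * Real.log n + 4 * Real.log m)
  nlinarith [sq_nonneg (a - b), mul_nonneg (sq_nonneg a) (sub_nonneg.2 hlog),
    mul_nonneg hm (sub_nonneg.2 hlog)]

variable {A I κ : Type*} [Fintype A] [Fintype I] [DecidableEq A] [DecidableEq I] [DecidableEq κ]
  {Θ : A → Type*} [∀ a, Fintype (Θ a)] [∀ a, DecidableEq (Θ a)]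
  {X : Model A I κ Θ} {τ₀ ζ m p : ℕ} {Ω : Type*} {mΩ : MeasurableSpace Ω} {Pr : Measure Ω}
  {ℱ : Filtration ℕ mΩ} {θ : ℕ → Ω → (a : A) → Θ a} {r : ℕ → Ω → A → ℝ}
  {α : ℕ → Ω → Finset (A × I)} {μ C : A × I → ℝ}

/-- The event that the empirical mean of `e` over the epochs `1, …, n` is off by at least the
confidence window of epoch `n + 1`. -/
def deviationEvent (τ₀ ζ m : ℕ) (C μ : A × I → ℝ) (r : ℕ → Ω → A → ℝ) (α : ℕ → Ω → Finset (A × I))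
    (n : ℕ) (e : A × I) : Set Ω :=
  {ω | confidence τ₀ ζ m (C e) (pullCount α e n ω) (n + 1) ≤ |empiricalMean τ₀ ζ r α e n ω - μ e|}

namespace IsMGEUCB

theorem feasible (h : IsMGEUCB X τ₀ ζ m C p r α) (ω : Ω) {k : ℕ} (hk : 1 ≤ k) :
    Feasible X.cls X.cap (α k ω) := by
  rcases le_or_gt k p with hkp | hkp
  · exact h.initial_feasible ω k hk hkp
  · obtain ⟨n, rfl⟩ : ∃ n, k = n + 1 := ⟨k - 1, by omega⟩
    exact (h.greedy ω n (by omega)).feasible_and_blocked.1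

theorem pullCount_initial (h : IsMGEUCB X τ₀ ζ m C p r α) (ω : Ω) (e : A × I) :
    pullCount α e p ω = 1 := by
  obtain ⟨k, hk, huniq⟩ := h.initial_cover ω e
  refine card_eq_one.2 ⟨k, ?_⟩
  ext l
  simp only [mem_filter, mem_Icc, mem_singleton]
  exact ⟨huniq l, fun hl => hl ▸ hk⟩

variable [IsProbabilityMeasure Pr]

/-- The confidence window of epoch `n + 1` fails for `e` with probability at most `2 n` times a large
negative power of `(n + 1) m`; the factor `2 n` stems from the two tails and from the possible values
of the number of plays. -/
theorem measureReal_deviationEvent_le (h : IsMGEUCB X τ₀ ζ m C p r α)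
    (hproc : IsEpochProcess X τ₀ ζ Pr ℱ θ r α) (hτ₀ : 0 < τ₀) (hζ : 0 < ζ) (hm : 0 < m) {e : A × I}
    (hC : IsMixingConstant (X.P e) (X.meanReward e) (μ e) (C e)) (hμ : μ e ∈ Set.Icc (0 : ℝ) 1)
    {n : ℕ} (hpn : p ≤ n) :
    Pr.real (deviationEvent τ₀ ζ m C μ r α n e) ≤
      2 * (n * (((n : ℝ) + 1) ^ 12 * (m : ℝ) ^ 8)⁻¹) := by
  have hα : ∀ k, 1 ≤ k → ∀ ω, ∀ e ∈ α k ω, ∀ e' ∈ α k ω, e.1 = e'.1 → e = e' :=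
    fun k hk ω => (h.feasible ω hk).1
  set 𝒢 : Filtration ℕ mΩ :=
    ⟨fun k => ℱ (epochStart τ₀ ζ k), fun _ _ h => ℱ.mono (epochStart_mono τ₀ ζ h),
      fun _ => ℱ.le _⟩ with h𝒢
  set E : ℕ → Set Ω := fun k => {ω | e ∈ α k ω} with hE
  set R : ℕ → Ω → ℝ := fun k => epochReward τ₀ ζ r k e.1 with hR
  set δ : ℕ → ℝ := fun k => C e / (2 * epochLength τ₀ ζ k) with hδ
  set ε : ℕ → ℝ := fun j => Real.sqrt (6 / (j : ℝ) * Real.log ((n + 1 : ℕ) : ℝ) +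
    4 / (j : ℝ) * Real.log m) with hε
  have hδ0 : ∀ k, 0 ≤ δ k := fun k => div_nonneg hC.1.le (by positivity)
  have hEm : ∀ k, 1 ≤ k → MeasurableSet[𝒢 k] (E k) := fun k hk =>
    hproc.measurableSet_mem_policy hk e
  have hRm : ∀ k, 1 ≤ k → Measurable[𝒢 (k + 1)] (R k) := fun k _ =>
    hproc.measurable_epochReward k e.1
  have hR01 : ∀ k, 1 ≤ k → ∀ᵐ ω ∂Pr, ω ∈ E k → R k ω ∈ Set.Icc (0 : ℝ) 1 := fun k hk =>
    hproc.ae_epochReward_mem_Icc hτ₀ hk (hα k hk) e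
  have hRint : ∀ k, 1 ≤ k → IntegrableOn (R k) (E k) Pr := fun k hk =>
    Integrable.of_mem_Icc 0 1 ((hRm k hk).mono (𝒢.le _) le_rfl).aemeasurable
      ((ae_restrict_iff' (𝒢.le _ _ (hEm k hk))).2 (hR01 k hk))
  have hmean : ∀ k, 1 ≤ k → ∀ G, MeasurableSet[𝒢 k] G → G ⊆ E k →
      |∫ ω in G, R k ω ∂Pr - μ e * Pr.real G| ≤ δ k * Pr.real G := fun k hk G hG hGE =>
    hproc.abs_setIntegral_epochReward_sub_le hτ₀ hk (hα k hk) e hC hG hGE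
  have hbias := fun (s : Finset ℕ) hs => sum_bias_le_mixingError hτ₀ hζ hC.1 s hs
  have hupper := measureReal_biased_excess_ge_le hEm hRm hR01 (ν := μ e) (δ := δ)
    (fun k => add_nonneg hμ.1 (hδ0 k))
    (fun k hk G hG hGE => by linarith [(abs_le.1 (hmean k hk G hG hGE)).2])
    hbias (ε := ε) (fun j => Real.sqrt_nonneg _) n
  have hlower := measureReal_biased_excess_ge_le (V := fun k ω => 1 - R k ω) hEm
    (fun k hk => (@measurable_const _ _ _ (𝒢 (k + 1)) (1 : ℝ)).sub (hRm k hk))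
    (fun k hk => (hR01 k hk).mono fun ω h hω =>
      ⟨sub_nonneg.2 (h hω).2, sub_le_self _ (h hω).1⟩) (ν := 1 - μ e) (δ := δ)
    (fun k => add_nonneg (sub_nonneg.2 hμ.2) (hδ0 k))
    (fun k hk G hG hGE => by
      rw [integral_sub (integrable_const (1 : ℝ)).integrableOn ((hRint k hk).mono_set hGE)]
      have := (abs_le.1 (hmean k hk G hG hGE)).1
      simp only [integral_const, measureReal_restrict_apply_univ, smul_eq_mul, mul_one]
      linarith)
    hbias (ε := ε) (fun j => Real.sqrt_nonneg _) n
  have hn1 : (0 : ℝ) < (n : ℝ) + 1 := by positivity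
  have hm0 : (0 : ℝ) < m := by exact_mod_cast hm
  have hsum : ∑ j ∈ Icc 1 n, Real.exp (-(2 * j * ε j ^ 2)) =
      n * (((n : ℝ) + 1) ^ 12 * (m : ℝ) ^ 8)⁻¹ := by
    have hterm : ∀ j ∈ Icc 1 n, Real.exp (-(2 * j * ε j ^ 2)) =
        (((n : ℝ) + 1) ^ 12 * (m : ℝ) ^ 8)⁻¹ := by
      intro j hj
      have hj0 : (0 : ℝ) < j := by exact_mod_cast (mem_Icc.1 hj).1
      have hl1 : 0 ≤ Real.log ((n + 1 : ℕ) : ℝ) := Real.log_natCast_nonneg _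
      have hl2 : 0 ≤ Real.log (m : ℝ) := Real.log_natCast_nonneg _
      have hsq : ε j ^ 2 = 6 / (j : ℝ) * Real.log ((n + 1 : ℕ) : ℝ) + 4 / (j : ℝ) * Real.log m :=
        Real.sq_sqrt (by positivity)
      have hexp : 2 * j * ε j ^ 2 =
          ((12 : ℕ) : ℝ) * Real.log ((n : ℝ) + 1) + ((8 : ℕ) : ℝ) * Real.log m := by
        rw [hsq]
        push_cast
        field_simp
        ring
      rw [hexp, Real.exp_neg, Real.exp_add, Real.exp_nat_mul, Real.exp_nat_mul,
        Real.exp_log hn1, Real.exp_log hm0]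
    rw [sum_congr rfl hterm, sum_const, Nat.card_Icc, nsmul_eq_mul, add_tsub_cancel_right]
  rw [hsum] at hupper hlower
  refine (measureReal_mono (fun ω hω => ?_)).trans
    ((measureReal_union_le _ _).trans (add_le_add hupper hlower)) |>.trans (le_of_eq (by ring))
  have hcount := pullCount_eq_occurrences (α := α) e n ω
  have hT1 : 1 ≤ pullCount α e n ω :=
    (h.pullCount_initial ω e).symm.le.trans (pullCount_mono e ω hpn)
  have hT0 : (0 : ℝ) < pullCount α e n ω := by exact_mod_cast hT1
  have hex : excess E R (fun _ => μ e) n ω =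
      pullCount α e n ω * (empiricalMean τ₀ ζ r α e n ω - μ e) := by
    rw [empiricalMean, mul_sub, mul_div_cancel₀ _ hT0.ne', excess, sum_sub_distrib, sum_const,
      nsmul_eq_mul]
    unfold pullCount
    congr!
  have hex' : excess E (fun k ω => 1 - R k ω) (fun _ => 1 - μ e) n ω =
      -excess E R (fun _ => μ e) n ω := by
    unfold excess
    rw [← sum_neg_distrib]
    exact sum_congr rfl fun k _ => by ring
  have hconf : pullCount α e n ω * confidence τ₀ ζ m (C e) (pullCount α e n ω) (n + 1) =
      mixingError τ₀ ζ (C e) (pullCount α e n ω) + pullCount α e n ω * ε (pullCount α e n ω) := by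
    rw [confidence, mul_add, mul_div_cancel₀ _ hT0.ne']
  have hω : confidence τ₀ ζ m (C e) (pullCount α e n ω) (n + 1) ≤
    |empiricalMean τ₀ ζ r α e n ω - μ e| := hω
  rcases le_abs.1 hω with hω | hω
  · left
    have := mul_le_mul_of_nonneg_left hω hT0.le
    rw [hconf, ← hex, hcount] at this
    exact ⟨hcount ▸ hT1, this⟩
  · right
    have := mul_le_mul_of_nonneg_left hω hT0.le
    rw [hconf, mul_neg, ← hex, ← hex', hcount] at this
    exact ⟨hcount ▸ hT1, this⟩

/-- The probability that some confidence window of epoch `n + 1` fails. -/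
theorem measureReal_iUnion_deviationEvent_le (h : IsMGEUCB X τ₀ ζ m C p r α)
    (hproc : IsEpochProcess X τ₀ ζ Pr ℱ θ r α) (hτ₀ : 0 < τ₀) (hζ : 0 < ζ) (hm : 0 < m)
    (hA : Fintype.card A = m) (hI : Fintype.card I = m)
    (hC : ∀ e, IsMixingConstant (X.P e) (X.meanReward e) (μ e) (C e))
    (hμ : ∀ e, μ e ∈ Set.Icc (0 : ℝ) 1) {n : ℕ} (hpn : p ≤ n) (hn : 1 ≤ n) :
    Pr.real (⋃ e, deviationEvent τ₀ ζ m C μ r α n e) ≤ 1 / (n : ℝ) - 1 / ((n + 1 : ℕ) : ℝ) := by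
  have hn0 : (1 : ℝ) ≤ n := by exact_mod_cast hn
  have hm1 : (1 : ℝ) ≤ m := by exact_mod_cast hm
  calc Pr.real (⋃ e, deviationEvent τ₀ ζ m C μ r α n e)
      ≤ ∑ e, Pr.real (deviationEvent τ₀ ζ m C μ r α n e) := measureReal_iUnion_fintype_le _
    _ ≤ ∑ _e : A × I, 2 * ((n : ℝ) * (((n : ℝ) + 1) ^ 12 * (m : ℝ) ^ 8)⁻¹) :=
        sum_le_sum fun e _ =>
          h.measureReal_deviationEvent_le hproc hτ₀ hζ hm (hC e) (hμ e) hpn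
    _ = (m : ℝ) ^ 2 * (2 * n) / (((n : ℝ) + 1) ^ 12 * (m : ℝ) ^ 8) := by
        rw [sum_const, card_univ, Fintype.card_prod, hA, hI, nsmul_eq_mul]
        push_cast
        field_simp
    _ ≤ 1 / (n * ((n : ℝ) + 1)) := by
        rw [div_le_div_iff₀ (by positivity) (by positivity)]
        have h1 : (m : ℝ) ^ 2 ≤ (m : ℝ) ^ 8 := pow_le_pow_right₀ hm1 (by norm_num)
        have h2 : 2 * n * (n * ((n : ℝ) + 1)) ≤ ((n : ℝ) + 1) ^ 12 :=
          calc 2 * n * (n * ((n : ℝ) + 1)) ≤ ((n : ℝ) + 1) ^ 4 := by nlinarith [sq_nonneg (n : ℝ)]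
            _ ≤ _ := pow_le_pow_right₀ (by linarith) (by norm_num)
        calc (m : ℝ) ^ 2 * (2 * n) * (n * ((n : ℝ) + 1))
            = (m : ℝ) ^ 2 * (2 * n * (n * ((n : ℝ) + 1))) := by ring
          _ ≤ (m : ℝ) ^ 8 * ((n : ℝ) + 1) ^ 12 := by gcongr
          _ = _ := by ring
    _ = _ := by
        push_cast
        field_simp
        ring

end IsMGEUCB

/-- If all confidence windows of epoch `n + 1` hold and a sub-optimal edge is played in that epoch, then
one of the edges played, other than the heaviest benchmark edge, has not yet been played often enough:
otherwise the greedy algorithm would have returned the benchmark matching. -/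
theorem IsMGEUCB.exists_pullCount_lt (h : IsMGEUCB X τ₀ ζ m C p r α) (hτ₀ : 0 < τ₀) (hζ : 0 < ζ)
    (hm : 0 < m) {iStar : A → I} {σ : Fin m ≃ A} (hG : IsGreedyBenchmark X.cls X.cap μ iStar σ)
    (hΔ : ∀ e, e ≠ greedyEdge iStar σ ⟨0, hm⟩ → gap X.cls X.cap μ iStar σ e ≠ 0)
    (hC : ∀ e, 0 < C e) {n N : ℕ} (hpn : p ≤ n) (hnN : n < N) {ω : Ω}
    (hgood : ∀ e, ω ∉ deviationEvent τ₀ ζ m C μ r α n e) {e : A × I} (he : e ∈ subOptimal μ iStar)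
    (hplay : e ∈ α (n + 1) ω) :
    ∃ f, f ≠ greedyEdge iStar σ ⟨0, hm⟩ ∧ f ∈ α (n + 1) ω ∧
      (pullCount α f n ω : ℝ) <
        pullBound τ₀ m N (gap X.cls X.cap μ iStar σ f) (rho τ₀ ζ (C f)) := by
  by_contra! hcon
  have hgr := h.greedy ω n hpn
  have hF := hgr.feasible_and_blocked.1
  have hdev : ∀ f, |empiricalMean τ₀ ζ r α f n ω - μ f| <
      confidence τ₀ ζ m (C f) (pullCount α f n ω) (n + 1) := fun f => not_le.1 (hgood f)
  have hmem := hG.greedyEdge_mem hm hΔ hgr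
    (fun l => by
      have := (abs_lt.1 (hdev (greedyEdge iStar σ l))).1
      simp only [ucbWeight]
      linarith)
    (fun f hf hf0 => by
      have hpos := (hG.gap_spec hm hf0 (hF.mono (singleton_subset_iff.2 hf)) (hΔ f hf0)).1
      have hT1 : 1 ≤ pullCount α f n ω :=
        (h.pullCount_initial ω f).symm.le.trans (pullCount_mono f ω hpn)
      have h2 := two_mul_confidence_le hτ₀ hζ (hC f) hpos hT1 (by omega : 1 ≤ n + 1)
        (by omega : n + 1 ≤ N) (hcon f hf0 hf)
      have := (abs_lt.1 (hdev f)).2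
      simp only [ucbWeight]
      linarith)
    (σ.symm e.1)
  rw [greedyEdge_symm] at hmem
  have heq : e = (e.1, iStar e.1) := hF.1 _ hplay _ hmem rfl
  have he : μ e < μ (e.1, iStar e.1) := he
  rw [← heq] at he
  exact lt_irrefl _ he

variable [IsProbabilityMeasure Pr]

/-- The expected number of plays of a sub-optimal edge, in terms of any bound `x` on the number of plays
that the edges other than the heaviest benchmark edge need. -/
theorem IsMGEUCB.integral_pullCount_le (h : IsMGEUCB X τ₀ ζ m C p r α)
    (hproc : IsEpochProcess X τ₀ ζ Pr ℱ θ r α) (hτ₀ : 0 < τ₀) (hζ : 0 < ζ) (hm : 0 < m)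
    (hA : Fintype.card A = m) (hI : Fintype.card I = m)
    (hC : ∀ e, IsMixingConstant (X.P e) (X.meanReward e) (μ e) (C e))
    (hμ : ∀ e, μ e ∈ Set.Icc (0 : ℝ) 1)
    {iStar : A → I} {σ : Fin m ≃ A} (hG : IsGreedyBenchmark X.cls X.cap μ iStar σ)
    (hΔ : ∀ e, e ≠ greedyEdge iStar σ ⟨0, hm⟩ → gap X.cls X.cap μ iStar σ e ≠ 0)
    {e : A × I} (he : e ∈ subOptimal μ iStar) {N : ℕ} {x : ℝ} (hx0 : 0 ≤ x)
    (hx : ∀ f, f ≠ greedyEdge iStar σ ⟨0, hm⟩ → ∀ k : ℕ,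
      (k : ℝ) < pullBound τ₀ m N (gap X.cls X.cap μ iStar σ f) (rho τ₀ ζ (C f)) → (k : ℝ) < x) :
    ∫ ω, (pullCount α e N ω : ℝ) ∂Pr ≤ (m : ℝ) ^ 2 * x + 2 := by
  classical
  obtain ⟨ω₀⟩ : Nonempty Ω := nonempty_of_isProbabilityMeasure Pr
  have hp : 1 ≤ p := by
    obtain ⟨k, hk, -⟩ := h.initial_cover ω₀ e
    omega
  -- measurable hulls of the exceptional events
  set bad : ℕ → Set Ω := fun n => toMeasurable Pr (⋃ e, deviationEvent τ₀ ζ m C μ r α n e) with hbad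
  have hbadm : ∀ n, MeasurableSet (bad n) := fun n => measurableSet_toMeasurable _ _
  have hpoint : ∀ ω, (pullCount α e N ω : ℝ) ≤
      (1 + (m : ℝ) ^ 2 * x) + ∑ n ∈ Ico p N, (bad n).indicator (fun _ => (1 : ℝ)) ω := by
    intro ω
    set F : Finset (A × I) := univ.filter fun f => f ≠ greedyEdge iStar σ ⟨0, hm⟩ with hF
    have hsub : (Ico p N).filter (fun l => e ∈ α (l + 1) ω) ⊆
        F.biUnion (fun f => (Ico p N).filter fun l =>
          f ∈ α (l + 1) ω ∧ (pullCount α f l ω : ℝ) < x) ∪ (Ico p N).filter fun l => ω ∈ bad l := by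
      intro l hl
      obtain ⟨hl, hle⟩ := mem_filter.1 hl
      by_cases hb : ω ∈ bad l
      · exact mem_union_right _ (mem_filter.2 ⟨hl, hb⟩)
      · have hgood : ∀ e, ω ∉ deviationEvent τ₀ ζ m C μ r α l e := fun e he =>
          hb (subset_toMeasurable _ _ (Set.mem_iUnion_of_mem e he))
        obtain ⟨f, hf0, hfl, hlt⟩ := h.exists_pullCount_lt hτ₀ hζ hm hG hΔ (fun e => (hC e).1)
          (mem_Ico.1 hl).1 (mem_Ico.1 hl).2 hgood he hle
        exact mem_union_left _ (mem_biUnion.2 ⟨f, mem_filter.2 ⟨mem_univ _, hf0⟩,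
          mem_filter.2 ⟨hl, hfl, hx f hf0 _ hlt⟩⟩)
    rcases le_or_gt p N with hpN | hNp
    · have hcard := (card_le_card hsub).trans ((card_union_le _ _).trans
        (Nat.add_le_add_right card_biUnion_le _))
      have h1 : (pullCount α e N ω : ℝ) ≤ 1 + ((∑ f ∈ F, ((Ico p N).filter fun l =>
          f ∈ α (l + 1) ω ∧ (pullCount α f l ω : ℝ) < x).card : ℕ) +
          (((Ico p N).filter fun l => ω ∈ bad l).card : ℝ)) := by
        exact_mod_cast (pullCount_le_one_add_card e ω (h.pullCount_initial ω e) N).trans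
          (Nat.add_le_add_left hcard 1)
      have h2 : ((∑ f ∈ F, ((Ico p N).filter fun l =>
          f ∈ α (l + 1) ω ∧ (pullCount α f l ω : ℝ) < x).card : ℕ) : ℝ) ≤ (m : ℝ) ^ 2 * x := by
        push_cast
        refine (sum_le_card_nsmul _ _ x fun f _ =>
          card_plays_below_le f ω hpN (h.pullCount_initial ω f).ge hx0).trans ?_
        rw [nsmul_eq_mul]
        refine mul_le_mul_of_nonneg_right ?_ hx0
        have : F.card ≤ m ^ 2 := by
          refine (card_le_univ _).trans (le_of_eq ?_)
          rw [Fintype.card_prod, hA, hI, sq]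
        exact_mod_cast this
      have h3 : (((Ico p N).filter fun l => ω ∈ bad l).card : ℝ) =
          ∑ n ∈ Ico p N, (bad n).indicator (fun _ => (1 : ℝ)) ω := by
        rw [card_filter]
        push_cast
        exact sum_congr rfl fun l _ => by simp [Set.indicator_apply]
      rw [h3] at h1
      linarith
    · have h1 := pullCount_le_one_add_card e ω (h.pullCount_initial ω e) N
      rw [Ico_eq_empty_of_le hNp.le] at h1 ⊢
      simp only [filter_empty, card_empty, add_zero, sum_empty] at h1 ⊢
      have : (pullCount α e N ω : ℝ) ≤ 1 := by exact_mod_cast h1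
      have : 0 ≤ (m : ℝ) ^ 2 * x := by positivity
      linarith
  have hind : ∀ n ∈ Ico p N, Integrable ((bad n).indicator fun _ => (1 : ℝ)) Pr := fun n _ =>
    (integrable_const 1).indicator (hbadm n)
  have hsum : ∑ n ∈ Ico p N, Pr.real (bad n) ≤ 1 := by
    have hterm : ∀ n ∈ Ico p N, Pr.real (bad n) ≤ 1 / (n : ℝ) - 1 / ((n + 1 : ℕ) : ℝ) := by
      intro n hn
      have hpn := (mem_Ico.1 hn).1
      have : Pr.real (bad n) = Pr.real (⋃ e, deviationEvent τ₀ ζ m C μ r α n e) := by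
        simp only [hbad, Measure.real, measure_toMeasurable]
      rw [this]
      exact h.measureReal_iUnion_deviationEvent_le hproc hτ₀ hζ hm hA hI hC hμ hpn (hp.trans hpn)
    refine (sum_le_sum hterm).trans ?_
    rcases le_or_gt p N with hpN | hNp
    · have htel := sum_Ico_sub (fun n : ℕ => -(1 / (n : ℝ))) hpN
      have heq : ∑ n ∈ Ico p N, (1 / (n : ℝ) - 1 / ((n + 1 : ℕ) : ℝ)) =
          1 / (p : ℝ) - 1 / (N : ℝ) := by
        have : 1 / (p : ℝ) - 1 / (N : ℝ) = -(1 / (N : ℝ)) - -(1 / (p : ℝ)) := by ring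
        rw [this, ← htel]
        exact sum_congr rfl fun n _ => by ring
      rw [heq]
      have h1 : 1 / (p : ℝ) ≤ 1 := by
        rw [div_le_one (by exact_mod_cast hp)]
        exact_mod_cast hp
      have h2 : 0 ≤ 1 / (N : ℝ) := by positivity
      linarith
    · simp [Ico_eq_empty_of_le hNp.le]
  calc ∫ ω, (pullCount α e N ω : ℝ) ∂Pr
      ≤ ∫ ω, ((1 + (m : ℝ) ^ 2 * x) + ∑ n ∈ Ico p N, (bad n).indicator (fun _ => (1 : ℝ)) ω) ∂Pr :=
        integral_mono_of_nonneg (ae_of_all _ fun ω => Nat.cast_nonneg _)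
          ((integrable_const _).add (integrable_finsetSum _ hind)) (ae_of_all _ hpoint)
    _ = (1 + (m : ℝ) ^ 2 * x) + ∑ n ∈ Ico p N, Pr.real (bad n) := by
        rw [integral_add (integrable_const _) (integrable_finsetSum _ hind),
          integral_finsetSum _ hind]
        simp [integral_indicator_const, hbadm]
    _ ≤ _ := by linarith

end Regret

end MGEUCB

open MGEUCB
theorem theorem2 {A I κ : Type*} [Fintype A] [Fintype I]
    [DecidableEq A] [DecidableEq I] [DecidableEq κ]
    {Θ : A → Type*} [∀ a, Fintype (Θ a)] [∀ a, DecidableEq (Θ a)]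
    (X : Model A I κ Θ)
    -- the stationary distributions and the stationary rewards
    (π : (e : A × I) → Θ e.1 → ℝ) (hπ : ∀ e, IsStationaryDist (X.P e) (π e))
    (μ : A × I → ℝ) (hμ : μ = X.stationaryReward π)
    -- as many incentives as agents, all matched by the greedy matching on the stationary rewards
    (m : ℕ) (hm : 0 < m) (_hA : Fintype.card A = m) (_hI : Fintype.card I = m)
    (iStar : A → I) (σ : Fin m ≃ A) (hG : IsGreedyBenchmark X.cls X.cap μ iStar σ)
    -- the gaps that occur in denominators do not vanish
    (Δ : A × I → ℝ) (hΔ : Δ = gap X.cls X.cap μ iStar σ)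
    (hΔ0 : ∀ e, e ≠ greedyEdge iStar σ ⟨0, hm⟩ → Δ e ≠ 0) :
    (∀ e, ∃ c, IsMixingConstant (X.P e) (X.meanReward e) (μ e) c) ∧
    ∀ (C : A × I → ℝ), (∀ e, IsMixingConstant (X.P e) (X.meanReward e) (μ e) (C e)) →
    ∀ (τ₀ ζ p : ℕ), 0 < τ₀ → 0 < ζ →
    ∀ {Ω : Type*} {mΩ : MeasurableSpace Ω} (Pr : Measure Ω) [IsProbabilityMeasure Pr]
      (ℱ : Filtration ℕ mΩ) (θ : ℕ → Ω → (a : A) → Θ a) (r : ℕ → Ω → A → ℝ)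
      (α : ℕ → Ω → Finset (A × I)),
      IsEpochProcess X τ₀ ζ Pr ℱ θ r α → IsMGEUCB X τ₀ ζ m C p r α →
      ∀ e ∈ subOptimal μ iStar,
        (∀ n : ℕ, 1 ≤ n → ∀ eStar : A × I, eStar ≠ greedyEdge iStar σ ⟨0, hm⟩ →
          (∀ e₁, e₁ ≠ greedyEdge iStar σ ⟨0, hm⟩ →
            ⌈pullBound τ₀ m n (Δ e₁) (rho τ₀ ζ (C e₁))⌉ ≤
              ⌈pullBound τ₀ m n (Δ eStar) (rho τ₀ ζ (C eStar))⌉) →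
          ∫ ω, (pullCount α e n ω : ℝ) ∂Pr ≤
            4 * (m : ℝ) ^ 2 / Δ eStar ^ 2 *
                (rho τ₀ ζ (C eStar) / Real.sqrt τ₀ +
                  Real.sqrt (6 * Real.log n + 4 * Real.log m)) ^ 2 +
              2 * (1 + Real.log n)) ∧
        (fun n : ℕ => ∫ ω, (pullCount α e n ω : ℝ) ∂Pr) =O[atTop] fun n : ℕ => Real.log n := by
  subst hμ hΔ
  refine ⟨fun e => exists_isMixingConstant (X.stochastic e) (X.irreducible e) (hπ e) _, ?_⟩
  intro C hC τ₀ ζ p hτ₀ hζ Ω mΩ Pr _ ℱ θ r α hproc hα e he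
  have hmain : ∀ n : ℕ, ∀ eStar : A × I,
      (∀ e₁, e₁ ≠ greedyEdge iStar σ ⟨0, hm⟩ →
        ⌈pullBound τ₀ m n (gap X.cls X.cap (X.stationaryReward π) iStar σ e₁) (rho τ₀ ζ (C e₁))⌉ ≤
          ⌈pullBound τ₀ m n (gap X.cls X.cap (X.stationaryReward π) iStar σ eStar)
            (rho τ₀ ζ (C eStar))⌉) →
      ∫ ω, (pullCount α e n ω : ℝ) ∂Pr ≤
        (m : ℝ) ^ 2 * pullBound τ₀ m n (gap X.cls X.cap (X.stationaryReward π) iStar σ eStar)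
          (rho τ₀ ζ (C eStar)) + 2 := by
    intro n eStar hmax
    refine hα.integral_pullCount_le hproc hτ₀ hζ hm _hA _hI hC
      (fun e => stationaryReward_mem_Icc (hπ e)) hG hΔ0 he (pullBound_nonneg _ _ _ _ _) ?_
    -- integers see no difference between a bound and its ceiling
    intro f hf k hk
    have h1 : ((k : ℤ) : ℝ) < pullBound τ₀ m n
      (gap X.cls X.cap (X.stationaryReward π) iStar σ f) (rho τ₀ ζ (C f)) := by exact_mod_cast hk
    have h2 := Int.lt_ceil.1 ((Int.lt_ceil.2 h1).trans_le (hmax f hf))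
    exact_mod_cast h2
  refine ⟨fun n _ eStar _ hmax => (hmain n eStar hmax).trans ?_, ?_⟩
  · have hlog : 0 ≤ Real.log (n : ℝ) := Real.log_natCast_nonneg _
    rw [pullBound]
    refine add_le_add (le_of_eq (by ring)) (by linarith)
  · choose K hK using fun f => exists_pullBound_le_mul_log τ₀ m
      (gap X.cls X.cap (X.stationaryReward π) iStar σ f) (rho τ₀ ζ (C f))
    have he0 : e ≠ greedyEdge iStar σ ⟨0, hm⟩ := by
      rintro rfl
      exact lt_irrefl (X.stationaryReward π (greedyEdge iStar σ ⟨0, hm⟩)) he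
    refine IsBigO.of_bound ((m : ℝ) ^ 2 * ∑ f, |K f| + 2) ?_
    filter_upwards [eventually_ge_atTop 3] with n hn
    have hlog : 1 ≤ Real.log n := by
      rw [Real.le_log_iff_exp_le (by positivity)]
      have h3 : (3 : ℝ) ≤ n := by exact_mod_cast hn
      linarith [Real.exp_one_lt_d9]
    obtain ⟨eStar, -, hmax⟩ := exists_max_image
      (univ.filter fun f => f ≠ greedyEdge iStar σ ⟨0, hm⟩)
      (fun f => ⌈pullBound τ₀ m n (gap X.cls X.cap (X.stationaryReward π) iStar σ f)
        (rho τ₀ ζ (C f))⌉) ⟨e, mem_filter.2 ⟨mem_univ _, he0⟩⟩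
    have hbound := hmain n eStar fun e₁ he₁ => hmax e₁ (mem_filter.2 ⟨mem_univ _, he₁⟩)
    have hKs : K eStar ≤ ∑ f, |K f| := (le_abs_self _).trans
      (single_le_sum (f := fun f => |K f|) (fun _ _ => abs_nonneg _) (mem_univ eStar))
    have hpull : pullBound τ₀ m n (gap X.cls X.cap (X.stationaryReward π) iStar σ eStar)
        (rho τ₀ ζ (C eStar)) ≤ (∑ f, |K f|) * Real.log n :=
      (hK eStar n hn).trans (mul_le_mul_of_nonneg_right hKs (by linarith))
    rw [Real.norm_of_nonneg (integral_nonneg fun ω => Nat.cast_nonneg _),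
      Real.norm_of_nonneg (by linarith)]
    have := mul_le_mul_of_nonneg_left hpull (by positivity : 0 ≤ (m : ℝ) ^ 2)
    nlinarith
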